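/- Let $d\ge 1$. A function $f:\mathbb R^d\to[0,\infty)$ is called log-concave if $f=e^{-V}$ with $V:\mathbb R^d\to\mathbb R\cup\{+\infty\}$ convex, and a function $p$ on $\mathbb Z^d$ is called log-concave if it is the restriction to $\mathbb Z^d$ of a log-concave function on $\mathbb R^d$, called an extension of $p$. For an integrable log-concave $f$ with $\int f>0$ and for a probability mass function $p$ on $\mathbb Z^d$ put $$[\mathrm{Cov}(f)]_{ij}=\frac{\int x_ix_jf}{\int f}-\frac{\int x_if\int x_jf}{(\int f)^2},\qquad [\mathrm{Cov}(p)]_{ij}=\sum_k k_ik_jp(k)-\sum_k k_ip(k)\sum_k k_jp(k),$$ and $\sigma(f)=\det(\mathrm{Cov}(f))^{1/(2d)}$. Say that $f$ is almost isotropic with constant $K$ if $|[\mathrm{Cov}(f)]_{ij}-\sigma(f)^2\delta_{ij}|\le K\sigma(f)$ for all $i,j$. Let $n\ge1$, let $S$ be a random vector in $\mathbb Z^d$ with probability mass function $p_S$, let $U_1,\dots,U_n$ be i.i.d. uniform random vectors on the unit cube $[0,1)^d$, independent of $S$, and let $f_n$ be the density of $S+U_1+\dots+U_n$, in the version defined at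 every point by $f_1(x)=p_S(k)$ for $x\in k+[0,1)^d$, $k\in\mathbb Z^d$, and $f_{m+1}(x)=\int_{[0,1)^d}f_m(x-u)\,du$. For $k\in\mathbb Z^d$ and $x\in k+[0,1)^d$ put $g_n(k,x)=f_n(x)-p_S(k)$. There are constants $C_d$, depending only on $d$, and $C_{d,n}$, depending only on $d$ and $n$, such that for every $K$ there is an $N=N(d,K)$ with the following property. If $n\ge1$ and $p_S$ has an integrable log-concave extension $f$ with $\int f>0$ that is almost isotropic with constant $K$ and satisfies $\sigma(f)\ge N$, then $f_n$ is indeed a density of $S+U_1+\dots+U_n$, $\det(\mathrm{Cov}(p_S))>0$, the functions $g_n(k,\cdot)$ are bounded on $k+[0,1)^d$, the two series below converge absolutely, and $$\Big|\sum_{k\in\mathbb Z^d}\ \sup_{x\in k+[0,1)^d}g_n(k,x)\Big|\le\frac{C_d}{\det(\mathrm{Cov}(p_S))^{1/(2d)}},\qquad \sum_{k\in\mathbb Z^d}\ \sup_{x\in k+[0,1)^d}|g_n(k,x)|\le\frac{C_{d,n}}{\det(\mathrm{Cov}(p_S))^{1/(2d)}}.$$ -/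

import Mathlib

open MeasureTheory ProbabilityTheory

/-- The canonical embedding of `ℤ^d` in `ℝ^d`. -/
def latticePoint {d : ℕ} (k : Fin d → ℤ) : Fin d → ℝ := fun i => (k i : ℝ)

/-- The half-open unit cube `k + [0,1)^d`. -/
def cubeAt {d : ℕ} (k : Fin d → ℤ) : Set (Fin d → ℝ) :=
  {x | ∀ i, (k i : ℝ) ≤ x i ∧ x i < (k i : ℝ) + 1}

/-- A log-concave function `f = e^{-V}` on `ℝ^d` with `V : ℝ^d → ℝ ∪ {+∞}` convex, written
multiplicatively. The weights are positive, so that `f x = 0` (that is, `V x = +∞`)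
imposes no condition. -/
def IsLogConcave {d : ℕ} (f : (Fin d → ℝ) → ℝ) : Prop :=
  (∀ x, 0 ≤ f x) ∧
    ∀ x y : Fin d → ℝ, ∀ a b : ℝ, 0 < a → 0 < b → a + b = 1 →
      f x ^ a * f y ^ b ≤ f (a • x + b • y)

/-- `f` is a log-concave extension to `ℝ^d` of the function `p` on `ℤ^d`. A function `p` on `ℤ^d`
is log-concave (extensible) when it has such an extension. -/
def IsLogConcaveExtension {d : ℕ} (p : (Fin d → ℤ) → ℝ) (f : (Fin d → ℝ) → ℝ) : Prop :=
  IsLogConcave f ∧ ∀ k, f (latticePoint k) = p k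

/-- The covariance matrix of a nonnegative function on `ℝ^d`. -/
noncomputable def covReal {d : ℕ} (f : (Fin d → ℝ) → ℝ) : Matrix (Fin d) (Fin d) ℝ :=
  Matrix.of fun i j =>
    (∫ x, x i * x j * f x) / (∫ x, f x) -
      ((∫ x, x i * f x) * (∫ x, x j * f x)) / (∫ x, f x) ^ 2

/-- The covariance matrix of a nonnegative function on `ℤ^d`. -/
noncomputable def covInt {d : ℕ} (p : (Fin d → ℤ) → ℝ) : Matrix (Fin d) (Fin d) ℝ :=
  Matrix.of fun i j =>
    (∑' k, (k i : ℝ) * (k j : ℝ) * p k) / (∑' k, p k) -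
      ((∑' k, (k i : ℝ) * p k) * (∑' k, (k j : ℝ) * p k)) / (∑' k, p k) ^ 2

/-- The scale `σ = det(A)^{1/(2d)}` of a covariance matrix `A`. -/
noncomputable def detScale {d : ℕ} (A : Matrix (Fin d) (Fin d) ℝ) : ℝ :=
  A.det ^ (1 / (2 * (d : ℝ)))

/-- Almost isotropy with implied constant `K`: with `σ = det(Cov f)^{1/(2d)}`, the diagonal entries
of `Cov f` are within `K σ` of `σ²` and the other ones are at most `K σ` in absolute value.
A family is almost isotropic, as `σ → ∞`, when its members with `σ` large satisfy this with a
common `K`. -/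
def IsAlmostIsotropicWith {d : ℕ} (K : ℝ) (f : (Fin d → ℝ) → ℝ) : Prop :=
  ∀ i j, |covReal f i j - (if i = j then detScale (covReal f) ^ 2 else 0)|
    ≤ K * detScale (covReal f)

/-- The probability mass function of a random vector in `ℤ^d`. -/
noncomputable def massFunction {Ω : Type*} [MeasurableSpace Ω] {d : ℕ} (P : Measure Ω)
    (S : Ω → (Fin d → ℤ)) (k : Fin d → ℤ) : ℝ :=
  P.real (S ⁻¹' {k})

/-- The everywhere-defined density `f_n` of `S + U_1 + ⋯ + U_n`, for `n ≥ 1`, where `S` has mass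
function `p` and the `U_i` are uniform on the unit cube: `f_1 = p(k)` on `k + [0,1)^d`, and
`f_{n+1}(x) = ∫_{[0,1)^d} f_n(x - u) du`. The value at `n = 0` is a dummy. -/
noncomputable def smoothedDensity {d : ℕ} (p : (Fin d → ℤ) → ℝ) : ℕ → (Fin d → ℝ) → ℝ
  | 0 => fun _ => 0
  | 1 => fun x => p (fun i => ⌊x i⌋)
  | n + 2 => fun x => ∫ u in cubeAt (0 : Fin d → ℤ), smoothedDensity p (n + 1) (x - u)

/-- `g(k,x) = f_n(x) - p(k)`. -/
noncomputable def densityError {d : ℕ} (p : (Fin d → ℤ) → ℝ) (n : ℕ) (k : Fin d → ℤ)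
    (x : Fin d → ℝ) : ℝ :=
  smoothedDensity p n x - p k

/-! Everything rests on one estimate: with `σ` the scale of the extension `f`, the `ℓ¹` distance
between `p` and its translate by a unit vector is `O(1/σ)`.

To get it, `f` is put in affine position. Around a near-maximum `x₀`, a simplex of nearly maximal
volume in the level set `f ≥ f x₀ / 4` supplies new axes, the rows of a matrix `W`. In these
coordinates the level set contains a fixed cube and lies in a fixed ball, so log-concavity forces
exponential decay with constants depending only on `d`. Since `Cov f = Wᵀ Cov(h) W` for the
normalized function `h`, the determinant bounds `|det W|` below by a multiple of `σ^d`, and the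
diagonal bounds the entries of `W` above by a multiple of `σ`. Hence `f` decays at rate `1/σ` and
has a plateau of radius of order `σ` (`IsLogConcave.exists_exp_bounds`). Counting lattice points on
the plateau gives `p(k) ≤ M σ^{-d} exp(-b‖k - a‖/σ)`.

On a line parallel to an axis `p` is unimodal, so its variation there is twice its maximum. The
maximizers, one per line, form a `(d-1)`-dimensional family, so the maxima sum to `O(σ^{d-1}
σ^{-d})` (`IsLineQuasiConcave.tsum_variation_le`).

Finally `f_n(x)` is the mean of `p(⌊x - w⌋)`, with `w` a sum of `n - 1` uniform vectors. For `x` in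
the cube at `k`, `⌊x - w⌋ - k` lies in a box of side `n - 1`, which gives the constant depending on
`n`. For the signed sum, `⌊x - w⌋` is compared with `k + ⌊-w⌋` instead: the difference lies in
`{0,1}^d` for every `n`, and replacing `p(k)` by the mean of `p(k + ⌊-w⌋)` does not change the sum
over `k` (`densityError_bounds`). Passing from `σ(f)` to `det Cov(p)` needs only the upper bound
`σ(p) ≤ L σ(f)`, which follows from the decay. -/

/-! ### Log-concave functions: boundedness and position -/

namespace IsLogConcave

variable {d : ℕ} {f : (Fin d → ℝ) → ℝ}

theorem convex_superlevel (hf : IsLogConcave f) {t : ℝ} (ht : 0 ≤ t) : Convex ℝ {x | t ≤ f x} := by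
  rw [convex_iff_forall_pos]
  intro x hx y hy a b ha hb hab
  refine le_trans ?_ (hf.2 x y a b ha hb hab)
  calc t = t ^ a * t ^ b := by rw [← Real.rpow_add_of_nonneg ht ha.le hb.le, hab, Real.rpow_one]
    _ ≤ _ := mul_le_mul (Real.rpow_le_rpow ht hx ha.le) (Real.rpow_le_rpow ht hy hb.le)
      (Real.rpow_nonneg ht _) (Real.rpow_nonneg (hf.1 x) _)

theorem comp_affine (hf : IsLogConcave f) {F : ℝ} (hF : 0 < F) (x₀ : Fin d → ℝ)
    (A : (Fin d → ℝ) →ₗ[ℝ] (Fin d → ℝ)) : IsLogConcave fun c => f (x₀ + A c) / F := by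
  refine ⟨fun x => div_nonneg (hf.1 _) hF.le, fun x y a b ha hb hab => ?_⟩
  have h := hf.2 (x₀ + A x) (x₀ + A y) a b ha hb hab
  have e : a • (x₀ + A x) + b • (x₀ + A y) = x₀ + A (a • x + b • y) := by
    rw [map_add, map_smul, map_smul]
    calc _ = (a + b) • x₀ + (a • A x + b • A y) := by module
      _ = _ := by rw [hab, one_smul]
  rw [e] at h
  rw [Real.div_rpow (hf.1 _) hF.le, Real.div_rpow (hf.1 _) hF.le, div_mul_div_comm,
    ← Real.rpow_add hF, hab, Real.rpow_one]
  exact div_le_div_of_nonneg_right h hF.le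

theorem exists_superlevel_pos (hpos : 0 < ∫ x, f x) :
    ∃ t > 0, 0 < volume {x | t ≤ f x} := by
  by_contra! h
  have h0 : volume {x | 0 < f x} = 0 := by
    refine measure_mono_null (t := ⋃ n : ℕ, {x | 1 / ((n : ℝ) + 1) ≤ f x}) ?_
      (measure_iUnion_null fun n => le_antisymm (h _ (by positivity)) zero_le)
    intro x hx
    obtain ⟨n, hn⟩ := exists_nat_one_div_lt (show 0 < f x from hx)
    exact Set.mem_iUnion.2 ⟨n, hn.le⟩
  have h1 : ∀ᵐ x, f x ≤ 0 := by
    rw [ae_iff]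
    simpa using h0
  exact absurd (integral_nonpos_of_ae h1) (not_le.2 hpos)

/-- Contracting a level set `L` of positive measure halfway towards `y` gives a set of measure
`2^{-d} |L|` on which `f ≥ √(f(y) t)`. Markov's inequality then bounds `f y` uniformly. -/
theorem bddAbove_range (hf : IsLogConcave f) (hi : Integrable f) (hpos : 0 < ∫ x, f x) :
    BddAbove (Set.range f) := by
  obtain ⟨t, ht, hL⟩ := exists_superlevel_pos hpos
  set L := {x | t ≤ f x}
  have hfin : volume L < ⊤ := hi.measure_ge_lt_top ht
  set v := (volume L).toReal * (1 / 2) ^ d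
  have hv : 0 < v := mul_pos (ENNReal.toReal_pos hL.ne' hfin.ne) (by positivity)
  have key : ∀ y, f y ^ (1 / 2 : ℝ) * t ^ (1 / 2 : ℝ) * v ≤ ∫ x, f x := by
    intro y
    rcases (hf.1 y).eq_or_lt with h0 | h0
    · rw [← h0, Real.zero_rpow (by norm_num), zero_mul, zero_mul]
      exact hpos.le
    set ε := f y ^ (1 / 2 : ℝ) * t ^ (1 / 2 : ℝ)
    have hε : 0 < ε := mul_pos (Real.rpow_pos_of_pos h0 _) (Real.rpow_pos_of_pos ht _)
    have hm := mul_meas_ge_le_integral_of_nonneg (ae_of_all _ hf.1) hi ε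
    refine le_trans (mul_le_mul_of_nonneg_left ?_ hε.le) hm
    have hsub : AffineMap.homothety y (1 / 2 : ℝ) '' L ⊆ {x | ε ≤ f x} := by
      rintro _ ⟨x, hx, rfl⟩
      have h := hf.2 y x (1 / 2) (1 / 2) (by norm_num) (by norm_num) (by norm_num)
      have e : AffineMap.homothety y (1 / 2 : ℝ) x = (1 / 2 : ℝ) • y + (1 / 2 : ℝ) • x := by
        rw [AffineMap.homothety_apply, vsub_eq_sub, vadd_eq_add]
        module
      rw [Set.mem_ofPred_eq, e]
      exact le_trans (mul_le_mul_of_nonneg_left (Real.rpow_le_rpow ht.le hx (by norm_num))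
        (Real.rpow_nonneg h0.le _)) h
    have hv' : v = (volume (AffineMap.homothety y (1 / 2 : ℝ) '' L)).toReal := by
      rw [Measure.addHaar_image_homothety, ENNReal.toReal_mul, ENNReal.toReal_ofReal (abs_nonneg _),
        abs_of_nonneg (by positivity), Module.finrank_fin_fun, mul_comm]
    rw [hv']
    exact ENNReal.toReal_mono (hi.measure_ge_lt_top hε).ne (measure_mono hsub)
  refine ⟨((∫ x, f x) / (t ^ (1 / 2 : ℝ) * v)) ^ 2, ?_⟩
  rintro _ ⟨y, rfl⟩
  have ht' : 0 < t ^ (1 / 2 : ℝ) := Real.rpow_pos_of_pos ht _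
  have h1 : f y ^ (1 / 2 : ℝ) ≤ (∫ x, f x) / (t ^ (1 / 2 : ℝ) * v) := by
    rw [le_div_iff₀ (by positivity), ← mul_assoc]
    exact key y
  calc f y = (f y ^ (1 / 2 : ℝ)) ^ 2 := by
        rw [← Real.rpow_natCast, ← Real.rpow_mul (hf.1 y)]; norm_num
    _ ≤ _ := pow_le_pow_left₀ (Real.rpow_nonneg (hf.1 y) _) h1 2

/-- The factor 2 stands in for a maximum, which need not be attained because `f` is not assumed
upper semicontinuous. -/
theorem exists_near_max (hf : IsLogConcave f) (hi : Integrable f) (hpos : 0 < ∫ x, f x) :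
    ∃ x₀, 0 < f x₀ ∧ ∀ x, f x ≤ 2 * f x₀ := by
  have hb := hf.bddAbove_range hi hpos
  have hM : 0 < ⨆ x, f x := by
    by_contra! h
    exact absurd (integral_nonpos fun x => (le_ciSup hb x).trans h) (not_le.2 hpos)
  obtain ⟨x₀, hx⟩ := exists_lt_of_lt_ciSup (show (⨆ x, f x) / 2 < ⨆ x, f x by linarith)
  exact ⟨x₀, by linarith, fun x => (le_ciSup hb x).trans (by linarith)⟩

/-- A short step from `x₀` towards any point where `f > 0` stays in the level set. If the span were
proper, the support of `f` would lie in a translate of it and be null. -/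
theorem span_superlevel (hf : IsLogConcave f) (hpos : 0 < ∫ x, f x)
    {x₀ : Fin d → ℝ} (hx₀ : 0 < f x₀) :
    Submodule.span ℝ {y | f x₀ / 4 ≤ f (x₀ + y)} = ⊤ := by
  set V := Submodule.span ℝ {y | f x₀ / 4 ≤ f (x₀ + y)}
  by_contra hV
  have hmem : ∀ x, 0 < f x → x - x₀ ∈ V := by
    intro x hx
    have hlim : Filter.Tendsto (fun t : ℝ => f x₀ ^ (1 - t) * f x ^ t) (nhdsWithin 0 (Set.Ioi 0))
        (nhds (f x₀)) := by
      have h : ContinuousAt (fun t : ℝ => f x₀ ^ (1 - t) * f x ^ t) 0 := by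
        refine ContinuousAt.mul ?_ ?_
        · exact (Real.continuous_const_rpow hx₀.ne').continuousAt.comp
            (f := fun t : ℝ => 1 - t) (by fun_prop)
        · exact (Real.continuous_const_rpow hx.ne').continuousAt
      have h' := h.tendsto
      simp only [sub_zero, Real.rpow_one, Real.rpow_zero, mul_one] at h'
      exact h'.mono_left nhdsWithin_le_nhds
    obtain ⟨t, ht1, ht0, ht⟩ := ((hlim.eventually (lt_mem_nhds
      (show f x₀ / 4 < f x₀ by linarith))).and
      (Ioo_mem_nhdsGT (show (0 : ℝ) < 1 by norm_num))).exists
    have hK : t • (x - x₀) ∈ V := by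
      refine Submodule.subset_span ?_
      have h := hf.2 x₀ x (1 - t) t (by linarith) ht0 (by ring)
      have e : (1 - t) • x₀ + t • x = x₀ + t • (x - x₀) := by module
      rw [e] at h
      exact ht1.le.trans h
    exact (V.smul_mem_iff ht0.ne').1 hK
  have hnull : volume {x | 0 < f x} = 0 := by
    have h0 := Measure.addHaar_submodule volume V hV
    rw [← measure_preimage_add_right volume (-x₀)] at h0
    refine measure_mono_null (fun x hx => ?_) h0
    simpa [sub_eq_add_neg] using hmem x hx
  have h1 : ∀ᵐ x, f x ≤ 0 := by
    rw [ae_iff]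
    simpa using hnull
  exact absurd (integral_nonpos_of_ae h1) (not_le.2 hpos)

end IsLogConcave

/-! ### Simplices of nearly maximal volume in a convex set. -/

section Simplex

variable {d : ℕ} {K : Set (Fin d → ℝ)}

theorem exists_rows_det_ne_zero (hK : Submodule.span ℝ K = ⊤) :
    ∃ W : Matrix (Fin d) (Fin d) ℝ, (∀ j, W j ∈ K) ∧ W.det ≠ 0 := by
  have hK' : ⊤ ≤ Submodule.span ℝ K := hK.ge
  let B := Module.Basis.ofSpan hK'
  have : Fintype ↑((linearIndepOn_empty ℝ (id : (Fin d → ℝ) → _)).extend (Set.empty_subset K)) :=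
    FiniteDimensional.fintypeBasisIndex B
  have hc : Fintype.card ↑((linearIndepOn_empty ℝ (id : (Fin d → ℝ) → _)).extend
      (Set.empty_subset K)) = d := by
    rw [← Module.finrank_eq_card_basis B, Module.finrank_fin_fun]
  let B' := B.reindex (Fintype.equivFinOfCardEq hc)
  refine ⟨Matrix.of fun j => B' j, fun j => ?_, ?_⟩
  · have : B' j ∈ Set.range B := by
      rw [Module.Basis.reindex_apply]
      exact Set.mem_range_self _
    exact Module.Basis.ofSpan_subset hK' this
  · have h := B'.linearIndependent
    have h2 := (Matrix.linearIndependent_rows_iff_isUnit (A := Matrix.of fun j => B' j)).1 h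
    exact ((Matrix.isUnit_iff_isUnit_det _).1 h2).ne_zero

theorem Convex.vecMul_mem (hd : 1 ≤ d) (hK : Convex ℝ K) (h0 : (0 : Fin d → ℝ) ∈ K)
    {W : Matrix (Fin d) (Fin d) ℝ} (hW : ∀ j, W j ∈ K) {c : Fin d → ℝ}
    (hc0 : ∀ j, 0 ≤ c j) (hc1 : ∀ j, c j ≤ 1 / d) : Matrix.vecMul c W ∈ K := by
  have hd' : (0 : ℝ) < d := by exact_mod_cast hd
  rw [Matrix.vecMul_eq_sum]
  have : ∑ i, c i • W i = ∑ i, (1 / (d : ℝ)) • ((d * c i) • W i) := by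
    refine Finset.sum_congr rfl fun i _ => ?_
    rw [smul_smul]
    congr 1
    field_simp
  rw [this]
  refine hK.sum_mem (fun _ _ => by positivity) ?_ fun i _ => ?_
  · simp [hd'.ne']
  · refine hK.smul_mem_of_zero_mem h0 (hW i) ⟨mul_nonneg hd'.le (hc0 i), ?_⟩
    have := mul_le_mul_of_nonneg_left (hc1 i) hd'.le
    rwa [mul_one_div_cancel hd'.ne'] at this

theorem vecMulLinear_det (W : Matrix (Fin d) (Fin d) ℝ) :
    LinearMap.det (W.vecMulLinear : (Fin d → ℝ) →ₗ[ℝ] Fin d → ℝ) = W.det := by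
  have : (W.vecMulLinear : (Fin d → ℝ) →ₗ[ℝ] _) = Matrix.toLin' W.transpose := by
    refine LinearMap.ext fun x => ?_
    simp [Matrix.mulVec_transpose]
  rw [this, LinearMap.det_toLin', Matrix.det_transpose]

theorem volume_vecMul_image (W : Matrix (Fin d) (Fin d) ℝ) (s : Set (Fin d → ℝ)) :
    volume (W.vecMulLinear '' s) = ENNReal.ofReal |W.det| * volume s := by
  rw [Measure.addHaar_image_linearMap, vecMulLinear_det]

/-- The image of `[0,1/d]^d` under `W` lies in `K` and has volume `|det W| / d^d`. -/
theorem abs_det_le_of_rows_mem (hd : 1 ≤ d) (hK : Convex ℝ K) (h0 : (0 : Fin d → ℝ) ∈ K)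
    (hfin : volume K ≠ ⊤) {W : Matrix (Fin d) (Fin d) ℝ} (hW : ∀ j, W j ∈ K) :
    |W.det| ≤ (volume K).toReal * d ^ d := by
  have hd' : (0 : ℝ) < d := by exact_mod_cast hd
  have hsub : W.vecMulLinear '' Set.Icc (0 : Fin d → ℝ) (fun _ => 1 / d) ⊆ K := by
    rintro _ ⟨c, hc, rfl⟩
    exact hK.vecMul_mem hd h0 hW hc.1 hc.2
  have h := ENNReal.toReal_mono hfin (measure_mono hsub)
  rw [volume_vecMul_image, ENNReal.toReal_mul, ENNReal.toReal_ofReal (abs_nonneg _),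
    Real.volume_Icc_pi_toReal (fun _ => by positivity)] at h
  simp only [Pi.zero_apply, sub_zero, Finset.prod_const, Finset.card_univ, Fintype.card_fin] at h
  rw [one_div, inv_pow, ← div_eq_mul_inv, div_le_iff₀ (by positivity)] at h
  exact h

/-- `K` need not be closed, so a maximal determinant is replaced by one within a factor 2 of the
supremum. -/
theorem exists_near_max_det (hd : 1 ≤ d) (hK : Convex ℝ K) (h0 : (0 : Fin d → ℝ) ∈ K)
    (hfin : volume K ≠ ⊤) (hspan : Submodule.span ℝ K = ⊤) :
    ∃ W : Matrix (Fin d) (Fin d) ℝ, (∀ j, W j ∈ K) ∧ W.det ≠ 0 ∧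
      ∀ W' : Matrix (Fin d) (Fin d) ℝ, (∀ j, W' j ∈ K) → |W'.det| ≤ 2 * |W.det| := by
  obtain ⟨W₀, hW₀, hdet⟩ := exists_rows_det_ne_zero hspan
  set D : Set ℝ := {x | ∃ W : Matrix (Fin d) (Fin d) ℝ, (∀ j, W j ∈ K) ∧ |W.det| = x}
  have hD : BddAbove D := by
    refine ⟨(volume K).toReal * d ^ d, ?_⟩
    rintro _ ⟨W, hW, rfl⟩
    exact abs_det_le_of_rows_mem hd hK h0 hfin hW
  have hD0 : |W₀.det| ∈ D := ⟨W₀, hW₀, rfl⟩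
  have hpos : 0 < sSup D := (abs_pos.2 hdet).trans_le (le_csSup hD hD0)
  obtain ⟨_, ⟨W, hW, rfl⟩, hlt⟩ := exists_lt_of_lt_csSup ⟨_, hD0⟩ (half_lt_self hpos)
  refine ⟨W, hW, fun h => ?_, fun W' hW' => ?_⟩
  · rw [h, abs_zero] at hlt
    linarith
  · have := le_csSup hD (show |W'.det| ∈ D from ⟨W', hW', rfl⟩)
    linarith

theorem det_updateRow_vecMul (W : Matrix (Fin d) (Fin d) ℝ) (c : Fin d → ℝ) (j : Fin d) :
    (W.updateRow j (Matrix.vecMul c W)).det = c j * W.det := by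
  rw [Matrix.vecMul_eq_sum, Matrix.det_updateRow_sum, smul_eq_mul]

/-- Cramer's rule: putting the point `cW` in place of row `j` multiplies the determinant by `c j`,
and near-maximality limits this factor to 2. -/
theorem norm_le_two_of_vecMul_mem {W : Matrix (Fin d) (Fin d) ℝ} (hW : ∀ j, W j ∈ K)
    (hdet : W.det ≠ 0)
    (hmax : ∀ W' : Matrix (Fin d) (Fin d) ℝ, (∀ j, W' j ∈ K) → |W'.det| ≤ 2 * |W.det|)
    {c : Fin d → ℝ} (hc : Matrix.vecMul c W ∈ K) : ‖c‖ ≤ 2 := by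
  rw [pi_norm_le_iff_of_nonneg (by norm_num)]
  intro j
  have h := hmax (W.updateRow j (Matrix.vecMul c W)) fun i => by
    by_cases hi : i = j
    · subst hi; simpa using hc
    · rw [Matrix.updateRow_ne hi]; exact hW i
  rw [det_updateRow_vecMul, abs_mul] at h
  exact le_of_mul_le_mul_right h (abs_pos.2 hdet)

end Simplex

/-! ### Log-concave functions in normalized position -/

/-- A log-concave function on `ℝ^d` with value `1` at the origin, at most `2` everywhere, at least
`1/4` on the cube `[0,1/d]^d` and less than `1/4` outside the ball of radius `2`. -/
structure IsNormalized {d : ℕ} (h : (Fin d → ℝ) → ℝ) : Prop where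
  logConcave : IsLogConcave h
  zero : h 0 = 1
  le_two : ∀ c, h c ≤ 2
  cube : ∀ c : Fin d → ℝ, (∀ j, 0 ≤ c j) → (∀ j, c j ≤ 1 / d) → 1 / 4 ≤ h c
  norm_le : ∀ c, 1 / 4 ≤ h c → ‖c‖ ≤ 2

theorem IsLogConcave.exists_isNormalized {d : ℕ} (hd : 1 ≤ d) {f : (Fin d → ℝ) → ℝ}
    (hf : IsLogConcave f) (hi : Integrable f) (hpos : 0 < ∫ x, f x) :
    ∃ (x₀ : Fin d → ℝ) (W : Matrix (Fin d) (Fin d) ℝ), 0 < f x₀ ∧ W.det ≠ 0 ∧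
      IsNormalized fun c => f (x₀ + W.vecMulLinear c) / f x₀ := by
  obtain ⟨x₀, hx₀, hmax⟩ := hf.exists_near_max hi hpos
  set K : Set (Fin d → ℝ) := {y | f x₀ / 4 ≤ f (x₀ + y)} with hKdef
  have hK : Convex ℝ K := by
    have := (hf.convex_superlevel (t := f x₀ / 4) (by linarith)).translate_preimage_right x₀
    exact this
  have h0 : (0 : Fin d → ℝ) ∈ K := by
    simp only [hKdef, Set.mem_ofPred_eq, add_zero]; linarith
  have hfin : volume K ≠ ⊤ := by
    have h := (hi.measure_ge_lt_top (show 0 < f x₀ / 4 by linarith)).ne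
    rwa [← measure_preimage_add volume x₀] at h
  obtain ⟨W, hW, hdet, hWmax⟩ := exists_near_max_det hd hK h0 hfin
    (hf.span_superlevel hpos hx₀)
  have hquarter : ∀ c, 1 / 4 ≤ f (x₀ + W.vecMulLinear c) / f x₀ ↔ Matrix.vecMul c W ∈ K := by
    intro c
    rw [le_div_iff₀ hx₀, one_div_mul_eq_div]
    rfl
  refine ⟨x₀, W, hx₀, hdet, hf.comp_affine hx₀ x₀ _, by simp [hx₀.ne'], fun c => ?_,
    fun c hc0 hc1 => ?_, fun c hc => ?_⟩
  · rw [div_le_iff₀ hx₀]; exact hmax _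
  · exact (hquarter c).2 (hK.vecMul_mem hd h0 hW hc0 hc1)
  · exact norm_le_two_of_vecMul_mem hW hdet hWmax ((hquarter c).1 hc)

/-- Outside the ball of radius 3, shrink `c` to norm 3, where `h < 1/4`. Log-concavity between the
origin, where `h = 1`, and `c` then gives `h c ≤ (1/4)^{‖c‖/3}`. Inside the ball, `2 ≤ 8/e`
suffices. -/
theorem IsNormalized.le_exp {d : ℕ} {h : (Fin d → ℝ) → ℝ} (hh : IsNormalized h) (c : Fin d → ℝ) :
    h c ≤ 8 * Real.exp (-(‖c‖ / 3)) := by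
  have he : Real.exp 1 < 2.7182818286 := Real.exp_one_lt_d9
  rcases lt_or_ge ‖c‖ 3 with hc | hc
  · have h1 : Real.exp (-1) ≤ Real.exp (-(‖c‖ / 3)) := Real.exp_le_exp.2 (by linarith)
    have h2 : 1 / 4 ≤ Real.exp (-1) := by
      rw [Real.exp_neg, ← one_div]
      exact one_div_le_one_div_of_le (Real.exp_pos _) (by linarith)
    linarith [hh.le_two c]
  · set r := ‖c‖ / 3 with hr
    have hr1 : 1 ≤ r := by rw [hr]; linarith
    have hr0 : 0 < r := by linarith
    have hsmall : h (r⁻¹ • c) < 1 / 4 := by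
      by_contra! hcon
      have := hh.norm_le _ hcon
      rw [norm_smul, norm_inv, Real.norm_of_nonneg hr0.le, inv_mul_le_iff₀ hr0] at this
      linarith
    have hle : h c ^ r⁻¹ ≤ h (r⁻¹ • c) := by
      rcases hr1.eq_or_lt with h1 | h1
      · simp [← h1]
      · have := hh.logConcave.2 0 c (1 - r⁻¹) r⁻¹ (by linarith [inv_lt_one_of_one_lt₀ h1])
          (by positivity) (by ring)
        rwa [hh.zero, Real.one_rpow, one_mul, smul_zero, zero_add] at this
    have hc0 := hh.logConcave.1 c
    have h3 : h c ≤ (1 / 4 : ℝ) ^ r := by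
      calc h c = (h c ^ r⁻¹) ^ r := by rw [← Real.rpow_mul hc0, inv_mul_cancel₀ hr0.ne',
              Real.rpow_one]
        _ ≤ _ := Real.rpow_le_rpow (Real.rpow_nonneg hc0 _) (hle.trans hsmall.le) hr0.le
    have h4 : (1 / 4 : ℝ) ^ r ≤ Real.exp (-r) := by
      rw [Real.exp_neg, one_div, Real.inv_rpow (by norm_num)]
      refine inv_anti₀ (Real.exp_pos _) ?_
      rw [← Real.exp_one_rpow]
      exact Real.rpow_le_rpow (Real.exp_pos _).le (by linarith) hr0.le
    linarith [Real.exp_pos (-r)]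

theorem integrable_pow_norm_mul_exp (d k : ℕ) :
    Integrable fun c : Fin d → ℝ => ‖c‖ ^ k * Real.exp (-(‖c‖ / 3)) := by
  have h := (integrable_one_add_norm (E := Fin d → ℝ) (μ := volume) (r := (d + 1 : ℝ))
    (by rw [Module.finrank_fin_fun]; linarith)).const_mul
      (Real.exp (1 / 3) * ((k + d + 1).factorial * 3 ^ (k + d + 1)))
  refine h.mono' (by fun_prop) (ae_of_all _ fun c => ?_)
  rw [Real.norm_of_nonneg (by positivity)]
  have hp : 0 < 1 + ‖c‖ := by positivity
  have h1 : ((1 + ‖c‖) / 3) ^ (k + d + 1) / (k + d + 1).factorial ≤ Real.exp ((1 + ‖c‖) / 3) :=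
    Real.pow_div_factorial_le_exp _ (by positivity) _
  have h2 : (1 + ‖c‖) ^ (k + d + 1) ≤
      ((k + d + 1).factorial * 3 ^ (k + d + 1)) * Real.exp ((1 + ‖c‖) / 3) := by
    rw [div_pow, div_div, div_le_iff₀ (by positivity)] at h1
    linarith
  have h3 : Real.exp ((1 + ‖c‖) / 3) = Real.exp (1 / 3) * Real.exp (‖c‖ / 3) := by
    rw [← Real.exp_add]; ring_nf
  have h4 : (1 + ‖c‖) ^ (-(d + 1 : ℝ)) = ((1 + ‖c‖) ^ (d + 1))⁻¹ := by
    rw [Real.rpow_neg hp.le, ← Real.rpow_natCast]; norm_num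
  rw [h4, Real.exp_neg, ← div_eq_mul_inv, ← div_eq_mul_inv,
    div_le_div_iff₀ (Real.exp_pos _) (by positivity)]
  calc ‖c‖ ^ k * (1 + ‖c‖) ^ (d + 1) ≤ (1 + ‖c‖) ^ k * (1 + ‖c‖) ^ (d + 1) := by
        gcongr; linarith
    _ = (1 + ‖c‖) ^ (k + d + 1) := by ring
    _ ≤ _ := h2
    _ = _ := by rw [h3]; ring

/-! ### Moments of normalized functions. -/

namespace IsNormalized

variable {d : ℕ} {h : (Fin d → ℝ) → ℝ}

/-- The constants bounding the moments of normalized functions. -/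
noncomputable def momentBound (d k : ℕ) : ℝ :=
  8 * ∫ c : Fin d → ℝ, ‖c‖ ^ k * Real.exp (-(‖c‖ / 3))

theorem integrable_mul (hh : IsNormalized h) (hi : Integrable h) {k : ℕ} {φ : (Fin d → ℝ) → ℝ}
    (hφ : Measurable φ) (hb : ∀ c, |φ c| ≤ ‖c‖ ^ k) : Integrable fun c => φ c * h c := by
  refine ((integrable_pow_norm_mul_exp d k).const_mul 8).mono'
    (hφ.aestronglyMeasurable.mul hi.aestronglyMeasurable) (ae_of_all _ fun c => ?_)
  rw [norm_mul, Real.norm_eq_abs, Real.norm_of_nonneg (hh.logConcave.1 c)]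
  calc |φ c| * h c ≤ ‖c‖ ^ k * (8 * Real.exp (-(‖c‖ / 3))) :=
        mul_le_mul (hb c) (hh.le_exp c) (hh.logConcave.1 c) (by positivity)
    _ = _ := by ring

theorem abs_integral_mul_le (hh : IsNormalized h) {k : ℕ} {φ : (Fin d → ℝ) → ℝ}
    (hb : ∀ c, |φ c| ≤ ‖c‖ ^ k) : |∫ c, φ c * h c| ≤ momentBound d k := by
  rw [momentBound, ← integral_const_mul, ← Real.norm_eq_abs]
  refine norm_integral_le_of_norm_le ((integrable_pow_norm_mul_exp d k).const_mul 8)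
    (ae_of_all _ fun c => ?_)
  rw [norm_mul, Real.norm_eq_abs, Real.norm_of_nonneg (hh.logConcave.1 c)]
  calc |φ c| * h c ≤ ‖c‖ ^ k * (8 * Real.exp (-(‖c‖ / 3))) :=
        mul_le_mul (hb c) (hh.le_exp c) (hh.logConcave.1 c) (by positivity)
    _ = _ := by ring

theorem abs_coord_le (i : Fin d) (c : Fin d → ℝ) : |c i| ≤ ‖c‖ ^ 1 := by
  rw [pow_one]; exact norm_le_pi_norm c i

theorem abs_coord_mul_le (i j : Fin d) (c : Fin d → ℝ) : |c i * c j| ≤ ‖c‖ ^ 2 := by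
  rw [abs_mul, sq]
  exact mul_le_mul (norm_le_pi_norm c i) (norm_le_pi_norm c j) (abs_nonneg _) (norm_nonneg _)

theorem integrable_coord (hh : IsNormalized h) (hi : Integrable h) (i : Fin d) :
    Integrable fun c => c i * h c :=
  hh.integrable_mul hi (by fun_prop) (abs_coord_le i)

theorem integrable_coord_mul (hh : IsNormalized h) (hi : Integrable h) (i j : Fin d) :
    Integrable fun c => c i * c j * h c :=
  hh.integrable_mul hi (by fun_prop) (abs_coord_mul_le i j)

/-- The half cube `[0,1/(2d)]^d`. -/
def halfCube (d : ℕ) : Set (Fin d → ℝ) := Set.Icc 0 fun _ => 1 / (2 * (d : ℝ))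

theorem volume_halfCube (d : ℕ) : volume.real (halfCube d) = (1 / (2 * (d : ℝ))) ^ d := by
  rw [halfCube, Measure.real, Real.volume_Icc_pi_toReal (fun _ => by positivity)]
  simp

theorem le_integral_of_halfCube {ψ : (Fin d → ℝ) → ℝ} (hψ : Integrable ψ) (h0 : ∀ c, 0 ≤ ψ c)
    {a : ℝ} (ha : ∀ c ∈ halfCube d, a ≤ ψ c) : a * (1 / (2 * (d : ℝ))) ^ d ≤ ∫ c, ψ c := by
  have hm : MeasurableSet (halfCube d) := measurableSet_Icc
  have hfin : volume (halfCube d) ≠ ⊤ := by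
    rw [halfCube]; exact (isCompact_Icc.measure_lt_top).ne
  calc a * (1 / (2 * (d : ℝ))) ^ d = ∫ c in halfCube d, a := by
        rw [setIntegral_const, volume_halfCube, smul_eq_mul, mul_comm]
    _ ≤ ∫ c in halfCube d, ψ c :=
        setIntegral_mono_on (integrableOn_const hfin) hψ.integrableOn hm ha
    _ ≤ _ := setIntegral_le_integral hψ (ae_of_all _ h0)

theorem le_integral (hh : IsNormalized h) (hi : Integrable h) :
    1 / 4 * (1 / (2 * (d : ℝ))) ^ d ≤ ∫ c, h c := by
  refine le_integral_of_halfCube hi hh.logConcave.1 fun c hc => hh.cube c hc.1 fun j => ?_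
  refine (hc.2 j).trans ?_
  rcases Nat.eq_zero_or_pos d with rfl | hd
  · exact j.elim0
  · have : (0 : ℝ) < d := by exact_mod_cast hd
    exact one_div_le_one_div_of_le this (by linarith)

/-- Pairing `c` with `c + e_j/(2d)` bounds the second moment of an affine function from below. -/
theorem sq_coeff_le_integral (hd : 1 ≤ d) (hh : IsNormalized h) {φ : (Fin d → ℝ) → ℝ}
    (hφi : Integrable fun c => φ c ^ 2 * h c) {θ : ℝ} (j : Fin d)
    (hφ : ∀ c, φ (c + Pi.single j (1 / (2 * (d : ℝ)))) = φ c + θ * (1 / (2 * (d : ℝ)))) :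
    θ ^ 2 * (1 / 16 * (1 / (2 * (d : ℝ))) ^ (d + 2)) ≤ ∫ c, φ c ^ 2 * h c := by
  have hd' : (0 : ℝ) < d := by exact_mod_cast hd
  set s := 1 / (2 * (d : ℝ)) with hs
  have hs0 : 0 < s := by positivity
  -- The half cube and its translate by `s` along axis `j` both lie in `[0,1/d]^d`, where `h ≥ 1/4`.
  have hs2 : s + s = 1 / d := by rw [hs]; field_simp; norm_num
  set e : Fin d → ℝ := Pi.single j s
  set ψ : (Fin d → ℝ) → ℝ := fun c => φ c ^ 2 * h c
  have h0 : ∀ c, 0 ≤ ψ c := fun c => mul_nonneg (sq_nonneg _) (hh.logConcave.1 c)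
  have h2 : ∫ c, (ψ c + ψ (c + e)) = 2 * ∫ c, ψ c := by
    rw [integral_add hφi (hφi.comp_add_right e), integral_add_right_eq_self]
    ring
  have h3 := le_integral_of_halfCube (a := (θ * s) ^ 2 / 8) (hφi.add (hφi.comp_add_right e))
    (fun c => add_nonneg (h0 _) (h0 _)) fun c hc => by
      have hc1 : 1 / 4 ≤ h c := hh.cube c hc.1 fun i => (hc.2 i).trans (by
        rw [← hs2]; exact le_add_of_nonneg_left hs0.le)
      have hc2 : 1 / 4 ≤ h (c + e) := by
        have hej : ∀ i, 0 ≤ e i ∧ e i ≤ s := fun i => by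
          by_cases hij : i = j
          · subst hij; simp [e, hs0.le]
          · simp [e, hij, hs0.le]
        refine hh.cube _ (fun i => add_nonneg (hc.1 i) (hej i).1) fun i => ?_
        rw [← hs2]; exact add_le_add (hc.2 i) (hej i).2
      show _ ≤ φ c ^ 2 * h c + φ (c + e) ^ 2 * h (c + e)
      rw [hφ]
      have e1 := mul_le_mul_of_nonneg_left hc1 (sq_nonneg (φ c))
      have e2 := mul_le_mul_of_nonneg_left hc2 (sq_nonneg (φ c + θ * s))
      -- Here `u² + v² ≥ (v - u)²/2` with `v - u = θ s`; the weight `1/4` turns this into `(θ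
      -- s)²/8`.
      nlinarith [sq_nonneg (φ c + (φ c + θ * s))]
  have h4 : ∫ c, ψ c + ψ (c + e) = ∫ c, ((fun c => φ c ^ 2 * h c) + fun c => φ (c + e) ^ 2 * h (c + e)) c := rfl
  rw [← h4, h2] at h3
  calc _ = ((θ * s) ^ 2 / 8 * s ^ d) / 2 := by ring
    _ ≤ _ := by linarith

end IsNormalized

/-! ### Covariance under affine changes of variables -/

section ChangeOfVariables

variable {d : ℕ}

theorem exists_vecMul_eq {W : Matrix (Fin d) (Fin d) ℝ} (hW : W.det ≠ 0) (y : Fin d → ℝ) :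
    ∃ c, Matrix.vecMul c W = y :=
  ⟨Matrix.vecMul y W⁻¹, by
    rw [Matrix.vecMul_vecMul, Matrix.nonsing_inv_mul _ (isUnit_iff_ne_zero.2 hW),
      Matrix.vecMul_one]⟩

theorem vecMul_injective {W : Matrix (Fin d) (Fin d) ℝ} (hW : W.det ≠ 0) :
    Function.Injective fun c => Matrix.vecMul c W :=
  Matrix.vecMul_injective_iff_isUnit.2 ((Matrix.isUnit_iff_isUnit_det _).2
    (isUnit_iff_ne_zero.2 hW))

theorem integral_eq_abs_det_mul_integral {W : Matrix (Fin d) (Fin d) ℝ} (hW : W.det ≠ 0)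
    (x₀ : Fin d → ℝ) (φ : (Fin d → ℝ) → ℝ) :
    ∫ x, φ x = |W.det| * ∫ c, φ (x₀ + W.vecMulLinear c) := by
  set A : (Fin d → ℝ) →L[ℝ] (Fin d → ℝ) := LinearMap.toContinuousLinearMap W.vecMulLinear with hA
  have h := integral_image_eq_integral_abs_det_fderiv_smul (F := ℝ) (volume : Measure (Fin d → ℝ))
    (s := Set.univ) (f := fun c => x₀ + A c) (f' := fun _ => A) MeasurableSet.univ
    (fun x _ => ((A.hasFDerivAt (x := x)).const_add x₀).hasFDerivWithinAt)
    (fun c _ c' _ hcc => vecMul_injective hW (add_left_cancel hcc)) φ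
  have himg : (fun c => x₀ + A c) '' Set.univ = Set.univ := by
    refine Set.eq_univ_of_forall fun y => ?_
    obtain ⟨c, hc⟩ := exists_vecMul_eq hW (y - x₀)
    refine ⟨c, Set.mem_univ _, ?_⟩
    show x₀ + Matrix.vecMul c W = y
    rw [hc]; abel
  have hdet : A.det = W.det := vecMulLinear_det W
  rw [himg, setIntegral_univ, setIntegral_univ, hdet] at h
  rw [h, ← integral_const_mul]
  rfl

theorem integrable_comp_affine {W : Matrix (Fin d) (Fin d) ℝ} (hW : W.det ≠ 0)
    (x₀ : Fin d → ℝ) {φ : (Fin d → ℝ) → ℝ} (hφ : Integrable φ) :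
    Integrable fun c => φ (x₀ + W.vecMulLinear c) := by
  set A : (Fin d → ℝ) →L[ℝ] (Fin d → ℝ) := LinearMap.toContinuousLinearMap W.vecMulLinear with hA
  have h := integrableOn_image_iff_integrableOn_abs_det_fderiv_smul (F := ℝ)
    (volume : Measure (Fin d → ℝ))
    (s := Set.univ) (f := fun c => x₀ + A c) (f' := fun _ => A) MeasurableSet.univ
    (fun x _ => ((A.hasFDerivAt (x := x)).const_add x₀).hasFDerivWithinAt)
    (fun c _ c' _ hcc => vecMul_injective hW (add_left_cancel hcc)) φ
  have h2 := h.1 hφ.integrableOn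
  have hdet : A.det = W.det := vecMulLinear_det W
  simp only [hdet, smul_eq_mul] at h2
  rw [integrableOn_univ, integrable_const_mul_iff
    (isUnit_iff_ne_zero.2 (abs_ne_zero.2 hW))] at h2
  exact h2

theorem integral_add_add {u v w : (Fin d → ℝ) → ℝ} (hu : Integrable u) (hv : Integrable v)
    (hw : Integrable w) : ∫ x, (u x + v x + w x) = (∫ x, u x) + (∫ x, v x) + ∫ x, w x := by
  rw [integral_add (f := fun x => u x + v x) (hu.add hv) hw, integral_add hu hv]

/-- The factor `F` and the Jacobian cancel in the quotients, and the terms in `x₀` cancel between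
the second moment and the product of means. -/
theorem covReal_affine {h f : (Fin d → ℝ) → ℝ} {W : Matrix (Fin d) (Fin d) ℝ} (hW : W.det ≠ 0)
    {x₀ : Fin d → ℝ} {F : ℝ} (hF : F ≠ 0) (hfh : ∀ c, f (x₀ + W.vecMulLinear c) = F * h c)
    (h0 : ∫ c, h c ≠ 0) (hi : Integrable h) (hi1 : ∀ i, Integrable fun c => c i * h c)
    (hi2 : ∀ i j, Integrable fun c => c i * c j * h c) :
    covReal f = W.transpose * covReal h * W := by
  have hD : |W.det| ≠ 0 := abs_ne_zero.2 hW
  set m := ∫ c, h c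
  set P : Fin d → ℝ := fun i => ∑ a, W a i * ∫ c, c a * h c
  set Q : Fin d → Fin d → ℝ := fun i j => ∑ a, ∑ b, W a i * W b j * ∫ c, c a * c b * h c
  have hval : ∀ i c, (x₀ + W.vecMulLinear c) i = x₀ i + ∑ a, W a i * c a := fun i c => by
    simp [Matrix.vecMul, dotProduct, mul_comm]
  have e0 : ∫ x, f x = |W.det| * F * m := by
    rw [integral_eq_abs_det_mul_integral hW x₀]
    simp only [hfh]
    rw [integral_const_mul]
    ring
  have hP : ∀ i, Integrable fun c => ∑ a, W a i * (c a * h c) := fun i =>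
    integrable_finsetSum _ fun a _ => (hi1 a).const_mul _
  have hQ : ∀ i j, Integrable fun c => ∑ a, ∑ b, W a i * W b j * (c a * c b * h c) := fun i j =>
    integrable_finsetSum _ fun a _ => integrable_finsetSum _ fun b _ => (hi2 a b).const_mul _
  have hPi : ∀ i, ∫ c, ∑ a, W a i * (c a * h c) = P i := fun i => by
    rw [integral_finsetSum _ fun a _ => (hi1 a).const_mul _]
    simp only [integral_const_mul, P]
  have hQi : ∀ i j, ∫ c, ∑ a, ∑ b, W a i * W b j * (c a * c b * h c) = Q i j := fun i j => by
    rw [integral_finsetSum _ fun a _ => integrable_finsetSum _ fun b _ => (hi2 a b).const_mul _]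
    refine Finset.sum_congr rfl fun a _ => ?_
    rw [integral_finsetSum _ fun b _ => (hi2 a b).const_mul _]
    simp only [integral_const_mul]
  have e1 : ∀ i, ∫ x, x i * f x = |W.det| * F * (x₀ i * m + P i) := fun i => by
    rw [integral_eq_abs_det_mul_integral hW x₀]
    have : (fun c => (x₀ + W.vecMulLinear c) i * f (x₀ + W.vecMulLinear c)) =
        fun c => F * (x₀ i * h c + ∑ a, W a i * (c a * h c)) := by
      funext c
      rw [hval, hfh, add_mul, Finset.sum_mul, mul_add, Finset.mul_sum]
      congr 1
      · ring
      · exact Finset.sum_congr rfl fun a _ => by ring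
    rw [this, integral_const_mul, integral_add (hi.const_mul _) (hP i), integral_const_mul, hPi]
    ring
  have e2 : ∀ i j, ∫ x, x i * x j * f x =
      |W.det| * F * (x₀ i * x₀ j * m + x₀ i * P j + x₀ j * P i + Q i j) := fun i j => by
    rw [integral_eq_abs_det_mul_integral hW x₀]
    have : (fun c => (x₀ + W.vecMulLinear c) i * (x₀ + W.vecMulLinear c) j *
          f (x₀ + W.vecMulLinear c)) =
        fun c => F * ((x₀ i * x₀ j * h c + x₀ i * ∑ a, W a j * (c a * h c) +
          x₀ j * ∑ a, W a i * (c a * h c)) + ∑ a, ∑ b, W a i * W b j * (c a * c b * h c)) := by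
      funext c
      have k1 : ∀ i, ∑ a, W a i * (c a * h c) = (∑ a, W a i * c a) * h c := fun i => by
        rw [Finset.sum_mul]; exact Finset.sum_congr rfl fun a _ => by ring
      have k2 : ∑ a, ∑ b, W a i * W b j * (c a * c b * h c) =
          (∑ a, W a i * c a) * (∑ b, W b j * c b) * h c := by
        rw [Finset.sum_mul_sum, Finset.sum_mul]
        refine Finset.sum_congr rfl fun a _ => ?_
        rw [Finset.sum_mul]
        exact Finset.sum_congr rfl fun b _ => by ring
      rw [hval, hval, hfh, k1, k1, k2]
      ring
    have hI : Integrable fun c => x₀ i * x₀ j * h c + x₀ i * ∑ a, W a j * (c a * h c) +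
        x₀ j * ∑ a, W a i * (c a * h c) :=
      ((hi.const_mul _).add ((hP j).const_mul _)).add ((hP i).const_mul _)
    rw [this, integral_const_mul, integral_add hI (hQ i j),
      integral_add_add (hi.const_mul _) ((hP j).const_mul _) ((hP i).const_mul _),
      integral_const_mul, integral_const_mul, integral_const_mul, hPi, hPi, hQi]
    ring
  ext i j
  have lhs : covReal f i j = Q i j / m - P i * P j / m ^ 2 := by
    rw [covReal, Matrix.of_apply, e0, e1, e1, e2]
    field_simp
    ring
  have rhs : (W.transpose * covReal h * W) i j = Q i j / m - P i * P j / m ^ 2 := by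
    calc (W.transpose * covReal h * W) i j = ∑ a, ∑ b, W a i * covReal h a b * W b j := by
          simp only [Matrix.mul_apply, Matrix.transpose_apply, Finset.sum_mul]
          exact Finset.sum_comm
      _ = ∑ a, ∑ b, (W a i * W b j * (∫ c, c a * c b * h c) / m -
          (W a i * ∫ c, c a * h c) * (W b j * ∫ c, c b * h c) / m ^ 2) := by
          refine Finset.sum_congr rfl fun a _ => Finset.sum_congr rfl fun b _ => ?_
          rw [covReal, Matrix.of_apply]
          ring
      _ = _ := by
          simp only [Finset.sum_sub_distrib, ← Finset.sum_div, P, Q, Finset.sum_mul_sum]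
  rw [lhs, rhs]

/-- With `m` the mean of the linear form `θ`, the quadratic form of the covariance is a variance, so
lower bounds on second moments apply to it. -/
theorem integral_sq_sub_mean {h : (Fin d → ℝ) → ℝ} (θ : Fin d → ℝ)
    (h0 : ∫ c, h c ≠ 0) (hi : Integrable h) (hi1 : ∀ i, Integrable fun c => c i * h c)
    (hi2 : ∀ i j, Integrable fun c => c i * c j * h c) :
    ∃ m : ℝ, (Integrable fun c => (∑ a, θ a * c a - m) ^ 2 * h c) ∧
      ∫ c, (∑ a, θ a * c a - m) ^ 2 * h c =
        (∫ c, h c) * ∑ a, ∑ b, θ a * θ b * covReal h a b := by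
  set P : ℝ := ∑ a, θ a * ∫ c, c a * h c with hPdef
  set Q : ℝ := ∑ a, ∑ b, θ a * θ b * ∫ c, c a * c b * h c with hQdef
  set m := P / ∫ c, h c
  have hP : Integrable fun c => ∑ a, θ a * (c a * h c) :=
    integrable_finsetSum _ fun a _ => (hi1 a).const_mul _
  have hQ : Integrable fun c => ∑ a, ∑ b, θ a * θ b * (c a * c b * h c) :=
    integrable_finsetSum _ fun a _ => integrable_finsetSum _ fun b _ => (hi2 a b).const_mul _
  have hPi : ∫ c, ∑ a, θ a * (c a * h c) = P := by
    rw [integral_finsetSum _ fun a _ => (hi1 a).const_mul _]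
    simp only [integral_const_mul, P]
  have hQi : ∫ c, ∑ a, ∑ b, θ a * θ b * (c a * c b * h c) = Q := by
    rw [integral_finsetSum _ fun a _ => integrable_finsetSum _ fun b _ => (hi2 a b).const_mul _]
    refine Finset.sum_congr rfl fun a _ => ?_
    rw [integral_finsetSum _ fun b _ => (hi2 a b).const_mul _]
    simp only [integral_const_mul]
  have e : (fun c => (∑ a, θ a * c a - m) ^ 2 * h c) =
      fun c => (∑ a, ∑ b, θ a * θ b * (c a * c b * h c) + (-2 * m) * ∑ a, θ a * (c a * h c)) +
        m ^ 2 * h c := by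
    funext c
    have k1 : ∑ a, θ a * (c a * h c) = (∑ a, θ a * c a) * h c := by
      rw [Finset.sum_mul]; exact Finset.sum_congr rfl fun a _ => by ring
    have k2 : ∑ a, ∑ b, θ a * θ b * (c a * c b * h c) =
        (∑ a, θ a * c a) * (∑ b, θ b * c b) * h c := by
      rw [Finset.sum_mul_sum, Finset.sum_mul]
      refine Finset.sum_congr rfl fun a _ => ?_
      rw [Finset.sum_mul]
      exact Finset.sum_congr rfl fun b _ => by ring
    rw [k1, k2]
    ring
  refine ⟨m, ?_, ?_⟩
  · rw [e]
    exact (hQ.add (hP.const_mul _)).add (hi.const_mul _)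
  · rw [e, integral_add_add hQ (hP.const_mul _) (hi.const_mul _), integral_const_mul, integral_const_mul, hPi, hQi]
    have rhs : ∑ a, ∑ b, θ a * θ b * covReal h a b =
        Q / (∫ c, h c) - P * P / (∫ c, h c) ^ 2 := by
      rw [hPdef, hQdef, Finset.sum_mul_sum]
      simp only [Finset.sum_div]
      rw [← Finset.sum_sub_distrib]
      refine Finset.sum_congr rfl fun a _ => ?_
      rw [← Finset.sum_sub_distrib]
      refine Finset.sum_congr rfl fun b _ => ?_
      rw [covReal, Matrix.of_apply]
      ring
    rw [rhs]
    simp only [m]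
    field_simp
    ring

end ChangeOfVariables

/-! ### Exponential bounds for log-concave functions in terms of the covariance -/

namespace IsNormalized

variable {d : ℕ} {h : (Fin d → ℝ) → ℝ}

theorem momentBound_nonneg (d k : ℕ) : 0 ≤ momentBound d k :=
  mul_nonneg (by norm_num) (integral_nonneg fun _ => by positivity)

theorem integral_le (hh : IsNormalized h) : ∫ c, h c ≤ momentBound d 0 := by
  have := hh.abs_integral_mul_le (k := 0) (φ := fun _ => 1) (by simp)
  simp only [one_mul] at this
  exact (le_abs_self _).trans this

/-- The lower bound for the mass of normalized functions. -/
noncomputable def massBound (d : ℕ) : ℝ := 1 / 4 * (1 / (2 * (d : ℝ))) ^ d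

/-- The bound for the covariances of normalized functions. -/
noncomputable def covBound (d : ℕ) : ℝ :=
  momentBound d 2 / massBound d + momentBound d 1 * momentBound d 1 / massBound d ^ 2

theorem massBound_pos (hd : 1 ≤ d) : 0 < massBound d := by
  have hd' : (0 : ℝ) < d := by exact_mod_cast hd
  rw [massBound]; positivity

theorem abs_covReal_le (hd : 1 ≤ d) (hh : IsNormalized h) (hi : Integrable h) (a b : Fin d) :
    |covReal h a b| ≤ covBound d := by
  have hm := massBound_pos hd
  have hm' : massBound d ≤ ∫ c, h c := hh.le_integral hi
  have h1 := fun a => hh.abs_integral_mul_le (abs_coord_le a)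
  have h2 := hh.abs_integral_mul_le (abs_coord_mul_le a b)
  rw [covReal, Matrix.of_apply, covBound]
  refine (abs_sub _ _).trans (add_le_add ?_ ?_)
  · rw [abs_div, abs_of_pos (hm.trans_le hm')]
    exact div_le_div₀ (momentBound_nonneg _ _) h2 hm hm'
  · rw [abs_div, abs_of_pos (pow_pos (hm.trans_le hm') 2), abs_mul]
    exact div_le_div₀ (mul_nonneg (momentBound_nonneg _ _) (momentBound_nonneg _ _))
      (mul_le_mul (h1 a) (h1 b) (abs_nonneg _) (momentBound_nonneg _ _)) (pow_pos hm 2)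
      (pow_le_pow_left₀ hm.le hm' 2)

/-- With `θ` a column of `W`, the right side is the mass of `h` times a diagonal entry of `Cov f`,
so this bounds the entries of `W`. -/
theorem sq_coeff_le_variance (hd : 1 ≤ d) (hh : IsNormalized h) (hi : Integrable h)
    (θ : Fin d → ℝ) (j : Fin d) :
    θ j ^ 2 * (1 / 16 * (1 / (2 * (d : ℝ))) ^ (d + 2)) ≤
      (∫ c, h c) * ∑ a, ∑ b, θ a * θ b * covReal h a b := by
  have hm0 : 0 < ∫ c, h c := (massBound_pos hd).trans_le (hh.le_integral hi)
  obtain ⟨m, hint, hval⟩ := integral_sq_sub_mean θ hm0.ne' hi (hh.integrable_coord hi)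
    (hh.integrable_coord_mul hi)
  rw [← hval]
  refine hh.sq_coeff_le_integral hd (φ := fun c => ∑ a, θ a * c a - m) hint j fun c => ?_
  simp only [Pi.add_apply, mul_add, Finset.sum_add_distrib, Pi.single_apply, mul_ite, mul_zero,
    Finset.sum_ite_eq', Finset.mem_univ, if_true]
  ring

end IsNormalized

/-- Working with `|det A|` avoids having to know the sign of the determinant. -/
theorem detScale_pow_le {d : ℕ} (hd : 1 ≤ d) {A : Matrix (Fin d) (Fin d) ℝ} (hA : 0 ≤ detScale A) :
    detScale A ^ (2 * d) ≤ |A.det| := by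
  have hd' : (0 : ℝ) < d := by exact_mod_cast hd
  have h1 : detScale A ≤ |A.det| ^ (1 / (2 * (d : ℝ))) :=
    (le_abs_self _).trans (Real.abs_rpow_le_abs_rpow _ _)
  calc detScale A ^ (2 * d) ≤ (|A.det| ^ (1 / (2 * (d : ℝ)))) ^ (2 * d) :=
        pow_le_pow_left₀ hA h1 _
    _ = |A.det| := by
      rw [← Real.rpow_natCast, ← Real.rpow_mul (abs_nonneg _)]
      push_cast
      rw [one_div_mul_cancel (by positivity), Real.rpow_one]

theorem abs_det_le_of_abs_le {d : ℕ} {A : Matrix (Fin d) (Fin d) ℝ} {B : ℝ}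
    (hA : ∀ i j, |A i j| ≤ B) : |A.det| ≤ d.factorial * B ^ d := by
  have := Matrix.det_le (abv := AbsoluteValue.abs) (A := A) (x := B) hA
  rw [Fintype.card_fin, nsmul_eq_mul] at this
  exact this

theorem norm_vecMul_le {d : ℕ} {W : Matrix (Fin d) (Fin d) ℝ} {B : ℝ} (hB : 0 ≤ B)
    (hW : ∀ i j, |W i j| ≤ B) (c : Fin d → ℝ) : ‖Matrix.vecMul c W‖ ≤ d * B * ‖c‖ := by
  rw [pi_norm_le_iff_of_nonneg (by positivity)]
  intro i
  calc ‖∑ j, c j * W j i‖ ≤ ∑ j, ‖c j * W j i‖ := norm_sum_le _ _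
    _ ≤ ∑ _j : Fin d, ‖c‖ * B := Finset.sum_le_sum fun j _ => by
        rw [norm_mul]
        exact mul_le_mul (norm_le_pi_norm c j) (hW j i) (norm_nonneg _) (norm_nonneg _)
    _ = d * B * ‖c‖ := by simp; ring

/-- Cramer's rule again: `c j * det W` is the determinant with row `j` replaced by `cW`, and after
extracting `r` all entries are at most `B`. -/
theorem abs_mul_det_le {d : ℕ} {W : Matrix (Fin d) (Fin d) ℝ} {B r : ℝ} (hr : 0 < r)
    (hW : ∀ i j, |W i j| ≤ B) {c : Fin d → ℝ} (hc : ‖Matrix.vecMul c W‖ ≤ r * B) (j : Fin d) :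
    |c j| * |W.det| ≤ r * (d.factorial * B ^ d) := by
  rw [← abs_mul, ← det_updateRow_vecMul,
    show Matrix.vecMul c W = r • (r⁻¹ • Matrix.vecMul c W) by rw [smul_inv_smul₀ hr.ne'],
    Matrix.det_updateRow_smul, abs_mul, abs_of_pos hr]
  refine mul_le_mul_of_nonneg_left (abs_det_le_of_abs_le fun i k => ?_) hr.le
  by_cases hi : i = j
  · subst hi
    rw [Matrix.updateRow_self, Pi.smul_apply, smul_eq_mul, abs_mul, abs_inv, abs_of_pos hr,
      inv_mul_le_iff₀ hr]
    exact (norm_le_pi_norm _ k).trans hc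
  · rw [Matrix.updateRow_ne hi]
    exact hW i k

/-- A matrix with entries `O(σ)` and determinant at least of order `σ^d` distorts lengths by a
factor comparable to `σ` in every direction. So the decay and the cube of the normalized function
carry over at scale `σ`. -/
theorem IsLogConcave.exists_exp_bounds (d : ℕ) (hd : 1 ≤ d) :
    ∃ b > 0, ∃ r > 0, ∀ f : (Fin d → ℝ) → ℝ, IsLogConcave f → Integrable f → 0 < ∫ x, f x →
      0 < detScale (covReal f) → (∀ i, covReal f i i ≤ 2 * detScale (covReal f) ^ 2) →
      ∃ F > 0, ∃ x₀ z : Fin d → ℝ,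
        (∀ x, f x ≤ 8 * F * Real.exp (-(b * ‖x - x₀‖ / detScale (covReal f)))) ∧
        ∀ x, ‖x - z‖ ≤ r * detScale (covReal f) → F / 4 ≤ f x := by
  have hd' : (0 : ℝ) < d := by exact_mod_cast hd
  set B := IsNormalized.covBound d + 1
  have hB0 : 0 ≤ IsNormalized.covBound d := by
    have := (IsNormalized.massBound_pos hd).le
    have h1 := IsNormalized.momentBound_nonneg d 1
    have h2 := IsNormalized.momentBound_nonneg d 2
    rw [IsNormalized.covBound]; positivity
  have hB : 0 < B := by positivity
  set q := 1 / 16 * (1 / (2 * (d : ℝ))) ^ (d + 2) with hq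
  have hq0 : 0 < q := by positivity
  set B₀ := IsNormalized.momentBound d 0
  have hB₀ : 0 ≤ B₀ := IsNormalized.momentBound_nonneg d 0
  set Λ := Real.sqrt (2 * B₀ / q) + 1
  have hΛ : 0 < Λ := by positivity
  set κ := Real.sqrt (1 / (d.factorial * B ^ d))
  have hκ : 0 < κ := Real.sqrt_pos.2 (by positivity)
  -- Chosen so that Cramer's bound `ρ d! (Λσ)^d` equals `κ σ^d / (2d)`.
  set ρ := 1 / (2 * d) * κ / (d.factorial * Λ ^ d) with hρ
  have hρ0 : 0 < ρ := by positivity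
  refine ⟨1 / (3 * (d * Λ)), by positivity, ρ * Λ, by positivity,
    fun f hf hi hpos hσ hdiag => ?_⟩
  set σ := detScale (covReal f) with hσdef
  obtain ⟨x₀, W, hF, hW, hh⟩ := hf.exists_isNormalized hd hi hpos
  set F := f x₀
  set h : (Fin d → ℝ) → ℝ := fun c => f (x₀ + W.vecMulLinear c) / F with hh_def
  have hfh : ∀ c, f (x₀ + W.vecMulLinear c) = F * h c := fun c => by
    rw [hh_def]; field_simp
  have hhi : Integrable h := (integrable_comp_affine hW x₀ hi).div_const F
  have hm0 : 0 < ∫ c, h c := (IsNormalized.massBound_pos hd).trans_le (hh.le_integral hhi)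
  have hcov := covReal_affine hW hF.ne' hfh hm0.ne' hhi (hh.integrable_coord hhi)
    (hh.integrable_coord_mul hhi)
  have hdet : κ * σ ^ d ≤ |W.det| := by
    have h1 := detScale_pow_le hd hσ.le
    rw [← hσdef, hcov, Matrix.det_mul, Matrix.det_mul, Matrix.det_transpose, abs_mul,
      abs_mul] at h1
    have h2 : |(covReal h).det| ≤ d.factorial * B ^ d := abs_det_le_of_abs_le fun i j =>
      (hh.abs_covReal_le hd hhi i j).trans (by linarith)
    have h3 : σ ^ (2 * d) ≤ |W.det| ^ 2 * (d.factorial * B ^ d) := by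
      calc _ ≤ _ := h1
        _ = |W.det| ^ 2 * |(covReal h).det| := by ring
        _ ≤ _ := mul_le_mul_of_nonneg_left h2 (sq_nonneg _)
    refine (sq_le_sq₀ (by positivity) (abs_nonneg _)).1 ?_
    rw [mul_pow, Real.sq_sqrt (by positivity), ← pow_mul, mul_comm d 2, one_div_mul_eq_div,
      div_le_iff₀ (by positivity)]
    exact h3
  have hWle : ∀ j i, |W j i| ≤ Λ * σ := fun j i => by
    have h1 := hh.sq_coeff_le_variance hd hhi (fun a => W a i) j
    have h2 : ∑ a, ∑ b, W a i * W b i * covReal h a b = covReal f i i := by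
      rw [hcov]
      simp only [Matrix.mul_apply, Matrix.transpose_apply, Finset.sum_mul]
      rw [Finset.sum_comm]
      exact Finset.sum_congr rfl fun a _ => Finset.sum_congr rfl fun b _ => by ring
    rw [h2, ← hq] at h1
    have h4 : W j i ^ 2 * q ≤ B₀ * (2 * σ ^ 2) :=
      h1.trans ((mul_le_mul_of_nonneg_left (hdiag i) hm0.le).trans
        (mul_le_mul_of_nonneg_right hh.integral_le (by positivity)))
    refine (sq_le_sq₀ (abs_nonneg _) (by positivity)).1 ?_
    calc |W j i| ^ 2 = W j i ^ 2 := sq_abs _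
      _ ≤ (2 * B₀ / q) * σ ^ 2 := by
        rw [div_mul_eq_mul_div, le_div_iff₀ hq0]; linarith
      _ = (Real.sqrt (2 * B₀ / q) * σ) ^ 2 := by
        rw [mul_pow, Real.sq_sqrt (by positivity)]
      _ ≤ (Λ * σ) ^ 2 := by
        gcongr
        exact le_add_of_nonneg_right zero_le_one
  -- The plateau is centred at the image of the midpoint of `[0,1/d]^d`.
  refine ⟨F, hF, x₀, x₀ + Matrix.vecMul (fun _ => 1 / (2 * (d : ℝ))) W, fun x => ?_,
    fun x hx => ?_⟩
  · obtain ⟨c, hc⟩ := exists_vecMul_eq hW (x - x₀)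
    have hx : x = x₀ + W.vecMulLinear c := by
      rw [Matrix.vecMulLinear_apply, hc]; abel
    have h1 := hh.le_exp c
    have h2 := norm_vecMul_le (by positivity) hWle c
    rw [hc] at h2
    calc f x = F * h c := by rw [hx, hfh]
      _ ≤ F * (8 * Real.exp (-(‖c‖ / 3))) := mul_le_mul_of_nonneg_left h1 hF.le
      _ = 8 * F * Real.exp (-(‖c‖ / 3)) := by ring
      _ ≤ _ := by
        refine mul_le_mul_of_nonneg_left (Real.exp_le_exp.2 (neg_le_neg ?_)) (by positivity)
        rw [div_le_iff₀ hσ, one_div_mul_eq_div, div_le_iff₀ (by positivity)]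
        calc _ ≤ _ := h2
          _ = _ := by ring
  · obtain ⟨c, hc⟩ := exists_vecMul_eq hW
      (x - (x₀ + Matrix.vecMul (fun _ => 1 / (2 * (d : ℝ))) W))
    rw [← hc, mul_assoc] at hx
    have hcj : ∀ j, |c j| ≤ 1 / (2 * d) := fun j => by
      have h1 := abs_mul_det_le hρ0 hWle hx j
      have h2 : |c j| * (κ * σ ^ d) ≤ 1 / (2 * d) * (κ * σ ^ d) := by
        calc _ ≤ |c j| * |W.det| := mul_le_mul_of_nonneg_left hdet (abs_nonneg _)
          _ ≤ _ := h1
          _ = 1 / (2 * d) * (κ * σ ^ d) := by rw [hρ, mul_pow]; field_simp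
      exact le_of_mul_le_mul_right h2 (by positivity)
    have hx' : x = x₀ + W.vecMulLinear ((fun _ => 1 / (2 * (d : ℝ))) + c) := by
      rw [Matrix.vecMulLinear_apply, Matrix.add_vecMul, hc]; abel
    have hs : 1 / (2 * (d : ℝ)) + 1 / (2 * d) = 1 / d := by field_simp; norm_num
    have h1 : 1 / 4 ≤ h ((fun _ => 1 / (2 * (d : ℝ))) + c) := by
      refine hh.cube _ (fun j => ?_) fun j => ?_
      · rw [Pi.add_apply]; linarith [(abs_le.1 (hcj j)).1]
      · rw [Pi.add_apply]; linarith [(abs_le.1 (hcj j)).2]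
    rw [hx', hfh]
    calc F / 4 = F * (1 / 4) := by ring
      _ ≤ _ := mul_le_mul_of_nonneg_left h1 hF.le

/-! ### Sums of exponentials over the lattice -/

section LatticeSums

theorem one_div_one_sub_exp_neg_le {x : ℝ} (hx : 0 < x) : (1 - Real.exp (-x))⁻¹ ≤ 1 + 1 / x := by
  have h1 : Real.exp (-x) ≤ 1 / (1 + x) := by
    rw [Real.exp_neg, ← one_div]
    exact one_div_le_one_div_of_le (by positivity) (by linarith [Real.add_one_le_exp x])
  have h2 : (1 + 1 / x)⁻¹ ≤ 1 - Real.exp (-x) := by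
    have : (1 + 1 / x)⁻¹ = 1 - 1 / (1 + x) := by field_simp; ring
    linarith
  exact inv_le_of_inv_le₀ (by positivity) h2

theorem summable_exp_neg_abs_sub {β : ℝ} (hβ : 0 < β) (a : ℝ) :
    Summable (fun t : ℤ => Real.exp (-(β * |t - a|))) ∧
      ∑' t : ℤ, Real.exp (-(β * |t - a|)) ≤ 2 * (1 + 1 / β) := by
  have hρ : Real.exp (-β) < 1 := by simpa using hβ
  -- Shifting by `⌊a⌋ + 1` lets the same geometric series dominate the terms on either side of `a`.
  set F : ℤ → ℝ := fun s => Real.exp (-(β * |((s + (⌊a⌋ + 1) : ℤ) : ℝ) - a|))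
  have hgeo := hasSum_geometric_of_lt_one (Real.exp_pos (-β)).le hρ
  have hpow : ∀ n : ℕ, Real.exp (-β) ^ n = Real.exp (-(β * n)) := fun n => by
    rw [← Real.exp_nat_mul]; ring_nf
  have h1 : ∀ n : ℕ, F n ≤ Real.exp (-β) ^ n := fun n => by
    rw [hpow]
    refine Real.exp_le_exp.2 (neg_le_neg (mul_le_mul_of_nonneg_left ?_ hβ.le))
    refine le_trans ?_ (le_abs_self _)
    push_cast
    linarith [Int.lt_floor_add_one a]
  have h2 : ∀ n : ℕ, F (-(n + 1)) ≤ Real.exp (-β) ^ n := fun n => by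
    rw [hpow]
    refine Real.exp_le_exp.2 (neg_le_neg (mul_le_mul_of_nonneg_left ?_ hβ.le))
    refine le_trans ?_ (neg_le_abs _)
    push_cast
    linarith [Int.floor_le a]
  have s1 : Summable fun n : ℕ => F n :=
    hgeo.summable.of_nonneg_of_le (fun _ => (Real.exp_pos _).le) h1
  have s2 : Summable fun n : ℕ => F (-(n + 1)) :=
    hgeo.summable.of_nonneg_of_le (fun _ => (Real.exp_pos _).le) h2
  have hs : HasSum F _ := HasSum.of_nat_of_neg_add_one s1.hasSum s2.hasSum
  have hs' := (Equiv.addRight (⌊a⌋ + 1)).hasSum_iff (f := fun t : ℤ => Real.exp (-(β * |t - a|)))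
    |>.1 hs
  refine ⟨hs'.summable, ?_⟩
  rw [hs'.tsum_eq]
  have t1 := (s1.tsum_le_tsum h1 hgeo.summable).trans_eq hgeo.tsum_eq
  have t2 := (s2.tsum_le_tsum h2 hgeo.summable).trans_eq hgeo.tsum_eq
  have := one_div_one_sub_exp_neg_le hβ
  linarith

/-- Enlarging `s` to the product of its projections makes the sum factor. -/
theorem sum_prod_le_pow {ι : Type*} [Fintype ι] {u : ι → ℤ → ℝ} {T : ℝ}
    (hu0 : ∀ i t, 0 ≤ u i t) (hu : ∀ i, Summable (u i)) (hT : ∀ i, ∑' t, u i t ≤ T)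
    (s : Finset (ι → ℤ)) : ∑ k ∈ s, ∏ i, u i (k i) ≤ T ^ Fintype.card ι := by
  classical
  calc ∑ k ∈ s, ∏ i, u i (k i)
      ≤ ∑ k ∈ Fintype.piFinset fun i => s.image fun k => k i, ∏ i, u i (k i) := by
        refine Finset.sum_le_sum_of_subset_of_nonneg (fun k hk => ?_) fun k _ _ =>
          Finset.prod_nonneg fun i _ => hu0 i _
        exact Fintype.mem_piFinset.2 fun i => Finset.mem_image_of_mem (fun k : ι → ℤ => k i) hk
    _ = ∏ i, ∑ t ∈ s.image fun k => k i, u i t := (Finset.prod_univ_sum _ _).symm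
    _ ≤ ∏ _i : ι, T := Finset.prod_le_prod (fun i _ => Finset.sum_nonneg fun t _ => hu0 i t)
        fun i _ => ((hu i).sum_le_tsum _ fun t _ => hu0 i t).trans (hT i)
    _ = _ := by simp

variable {d : ℕ}

/-- The sup norm dominates each coordinate, so the rate can be split into at most `d` shares of
`β/d`. Using fewer coordinates is allowed, which is what sums over transversals of lines need. -/
theorem exp_neg_norm_le_prod {ι : Type*} [Fintype ι] {e : ι → Fin d} (hι : Fintype.card ι ≤ d)
    (hd : 1 ≤ d) {β : ℝ} (hβ : 0 < β) (y : Fin d → ℝ) :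
    Real.exp (-(β * ‖y‖)) ≤ ∏ i, Real.exp (-(β / d * |y (e i)|)) := by
  have hd' : (0 : ℝ) < d := by exact_mod_cast hd
  rw [← Real.exp_sum]
  refine Real.exp_le_exp.2 ?_
  rw [Finset.sum_neg_distrib]
  refine neg_le_neg ?_
  calc ∑ i, β / d * |y (e i)| ≤ ∑ _i : ι, β / d * ‖y‖ := Finset.sum_le_sum fun i _ =>
        mul_le_mul_of_nonneg_left (norm_le_pi_norm y (e i)) (by positivity)
    _ = Fintype.card ι * (β / d * ‖y‖) := by simp
    _ ≤ d * (β / d * ‖y‖) := by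
        refine mul_le_mul_of_nonneg_right (by exact_mod_cast hι) (by positivity)
    _ = β * ‖y‖ := by field_simp

/-- The constant in the bounds for sums of exponentials of rate `b/σ`. -/
noncomputable def expSumConst (d : ℕ) (b : ℝ) : ℝ := 2 * (1 + d / b)

theorem expSumConst_pos {b : ℝ} (hb : 0 < b) : 0 < expSumConst d b := by
  rw [expSumConst]; positivity

theorem two_mul_le_expSumConst_mul {b σ : ℝ} (hb : 0 < b) (hσ : 1 ≤ σ) :
    2 * (1 + 1 / (b / σ / d)) ≤ expSumConst d b * σ := by
  have : 1 / (b / σ / d) = d / b * σ := by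
    rcases Nat.eq_zero_or_pos d with rfl | hd
    · simp
    · field_simp
  rw [this, expSumConst]
  have : 0 ≤ (d : ℝ) / b := by positivity
  nlinarith

/-- Taking all coordinates gives `σ^d`. Omitting one, for a set that meets each line in that
direction at most once, saves a factor `σ`. -/
theorem sum_exp_le_of_injOn {ι : Type*} [Fintype ι] {e : ι → Fin d} (hι : Fintype.card ι ≤ d)
    (hd : 1 ≤ d) {b σ : ℝ} (hb : 0 < b) (hσ : 1 ≤ σ) (a : Fin d → ℝ) (s : Finset (Fin d → ℤ))
    (hs : Set.InjOn (fun k : Fin d → ℤ => fun i => k (e i)) s) :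
    ∑ k ∈ s, Real.exp (-(b * ‖latticePoint k - a‖ / σ)) ≤
      (expSumConst d b * σ) ^ Fintype.card ι := by
  classical
  have hd' : (0 : ℝ) < d := by exact_mod_cast hd
  have hσ0 : 0 < σ := by linarith
  have hβ : 0 < b / σ / d := by positivity
  set u : ι → ℤ → ℝ := fun i t => Real.exp (-(b / σ / d * |t - a (e i)|))
  calc _ ≤ ∑ k ∈ s, ∏ i, u i (k (e i)) := Finset.sum_le_sum fun k _ => by
        have := exp_neg_norm_le_prod hι hd (show 0 < b / σ by positivity) (e := e)
          (latticePoint k - a)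
        rw [show b * ‖latticePoint k - a‖ / σ = b / σ * ‖latticePoint k - a‖ by ring]
        exact this
    _ = ∑ k ∈ s.image (fun k : Fin d → ℤ => fun i => k (e i)), ∏ i, u i (k i) := by
        rw [Finset.sum_image hs]
    _ ≤ _ := sum_prod_le_pow (fun _ _ => (Real.exp_pos _).le)
        (fun i => (summable_exp_neg_abs_sub hβ _).1)
        (fun i => (summable_exp_neg_abs_sub hβ _).2.trans (two_mul_le_expSumConst_mul hb hσ)) _

theorem sum_exp_le (hd : 1 ≤ d) {b σ : ℝ} (hb : 0 < b) (hσ : 1 ≤ σ) (a : Fin d → ℝ)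
    (s : Finset (Fin d → ℤ)) :
    ∑ k ∈ s, Real.exp (-(b * ‖latticePoint k - a‖ / σ)) ≤ (expSumConst d b * σ) ^ d := by
  have := sum_exp_le_of_injOn (ι := Fin d) (e := id) (by simp) hd hb hσ a s fun k _ k' _ h => h
  simpa using this

theorem summable_exp (hd : 1 ≤ d) {b σ : ℝ} (hb : 0 < b) (hσ : 1 ≤ σ) (a : Fin d → ℝ) :
    Summable fun k : Fin d → ℤ => Real.exp (-(b * ‖latticePoint k - a‖ / σ)) :=
  summable_of_sum_le (fun _ => (Real.exp_pos _).le) (sum_exp_le hd hb hσ a)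

/-- Half of the exponential rate absorbs the power. -/
theorem pow_mul_exp_le {b σ x : ℝ} (hb : 0 < b) (hσ : 0 < σ) (hx : 0 ≤ x) (n : ℕ) :
    x ^ n * Real.exp (-(b * x / σ)) ≤
      n.factorial * (2 * σ / b) ^ n * Real.exp (-(b / 2 * x / σ)) := by
  have h1 := Real.pow_div_factorial_le_exp (b / 2 * x / σ) (by positivity) n
  have h2 : x ^ n ≤ n.factorial * (2 * σ / b) ^ n * Real.exp (b / 2 * x / σ) := by
    have e : x ^ n = n.factorial * (2 * σ / b) ^ n * ((b / 2 * x / σ) ^ n / n.factorial) := by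
      field_simp
      rw [← mul_pow]
      congr 1
      field_simp
    rw [e]
    exact mul_le_mul_of_nonneg_left h1 (by positivity)
  calc _ ≤ n.factorial * (2 * σ / b) ^ n * Real.exp (b / 2 * x / σ) * Real.exp (-(b * x / σ)) :=
        mul_le_mul_of_nonneg_right h2 (Real.exp_pos _).le
    _ = _ := by
        rw [mul_assoc, ← Real.exp_add]
        ring_nf

/-- Moments of functions with exponential decay on the lattice. -/
theorem summable_mul_and_abs_tsum_le (hd : 1 ≤ d) {b σ M : ℝ} (hb : 0 < b) (hσ : 1 ≤ σ)
    (hM : 0 ≤ M) {a : Fin d → ℝ} {p : (Fin d → ℤ) → ℝ} (hp0 : ∀ k, 0 ≤ p k)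
    (hp : ∀ k, p k ≤ M / σ ^ d * Real.exp (-(b * ‖latticePoint k - a‖ / σ))) (n : ℕ)
    {φ : (Fin d → ℤ) → ℝ} (hφ : ∀ k, |φ k| ≤ ‖latticePoint k - a‖ ^ n) :
    Summable (fun k => φ k * p k) ∧
      |∑' k, φ k * p k| ≤ M * (n.factorial * (2 / b) ^ n) * expSumConst d (b / 2) ^ d * σ ^ n := by
  have hσ0 : 0 < σ := by linarith
  have hb2 : 0 < b / 2 := by positivity
  set E : (Fin d → ℤ) → ℝ := fun k => Real.exp (-(b / 2 * ‖latticePoint k - a‖ / σ))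
  set Q := M / σ ^ d * (n.factorial * (2 * σ / b) ^ n)
  have hle : ∀ k, |φ k * p k| ≤ Q * E k := fun k => by
    rw [abs_mul, abs_of_nonneg (hp0 k)]
    calc |φ k| * p k ≤ ‖latticePoint k - a‖ ^ n *
          (M / σ ^ d * Real.exp (-(b * ‖latticePoint k - a‖ / σ))) :=
          mul_le_mul (hφ k) (hp k) (hp0 k) (by positivity)
      _ = M / σ ^ d * (‖latticePoint k - a‖ ^ n *
          Real.exp (-(b * ‖latticePoint k - a‖ / σ))) := by ring
      _ ≤ M / σ ^ d * _ := mul_le_mul_of_nonneg_left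
          (pow_mul_exp_le hb hσ0 (norm_nonneg _) n) (by positivity)
      _ = Q * E k := by ring
  have hE := summable_exp hd hb2 hσ a
  have hEs : ∑' k, E k ≤ (expSumConst d (b / 2) * σ) ^ d :=
    hE.tsum_le_of_sum_le (sum_exp_le hd hb2 hσ a)
  have habs : Summable fun k => |φ k * p k| :=
    (hE.mul_left Q).of_nonneg_of_le (fun _ => abs_nonneg _) hle
  refine ⟨habs.of_abs, ?_⟩
  calc |∑' k, φ k * p k| ≤ ∑' k, |φ k * p k| := by
        simpa using norm_tsum_le_tsum_norm (f := fun k => φ k * p k) (by simpa using habs)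
    _ ≤ ∑' k, Q * E k := habs.tsum_le_tsum hle (hE.mul_left Q)
    _ = Q * ∑' k, E k := tsum_mul_left
    _ ≤ Q * (expSumConst d (b / 2) * σ) ^ d := mul_le_mul_of_nonneg_left hEs (by positivity)
    _ = _ := by
      simp only [Q, mul_pow, div_pow]
      field_simp

end LatticeSums

/-! ### Total variation along coordinate lines -/

section LineVariation

variable {d : ℕ}

/-- A function on `ℤ^d` that is quasi-concave along the lines parallel to the axes. -/
def IsLineQuasiConcave (p : (Fin d → ℤ) → ℝ) : Prop :=
  ∀ (k : Fin d → ℤ) (i : Fin d) (s t u : ℤ), s ≤ t → t ≤ u →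
    min (p (Function.update k i s)) (p (Function.update k i u)) ≤ p (Function.update k i t)

theorem IsLogConcave.isLineQuasiConcave {f : (Fin d → ℝ) → ℝ} (hf : IsLogConcave f) :
    IsLineQuasiConcave fun k => f (latticePoint k) := by
  intro k i s t u hst htu
  set m := min (f (latticePoint (Function.update k i s))) (f (latticePoint (Function.update k i u)))
  have hm : 0 ≤ m := le_min (hf.1 _) (hf.1 _)
  have hc := hf.convex_superlevel hm
  have hseg : latticePoint (Function.update k i t) ∈
      segment ℝ (latticePoint (Function.update k i s)) (latticePoint (Function.update k i u)) := by
    rcases hst.eq_or_lt with rfl | h1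
    · exact left_mem_segment _ _ _
    have h1' : (s : ℝ) < t := by exact_mod_cast h1
    have h2' : (t : ℝ) ≤ u := by exact_mod_cast htu
    have h3 : (0 : ℝ) < u - s := by linarith
    refine ⟨(u - t) / (u - s), (t - s) / (u - s), by apply div_nonneg <;> linarith,
      by apply div_nonneg <;> linarith, by field_simp; ring, ?_⟩
    funext j
    by_cases hj : j = i
    · subst hj
      simp only [latticePoint, Pi.add_apply, Pi.smul_apply, smul_eq_mul, Function.update_self]
      field_simp
      ring
    · simp only [latticePoint, Pi.add_apply, Pi.smul_apply, smul_eq_mul,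
        Function.update_of_ne hj]
      field_simp
      ring
  exact hc.segment_subset (x := latticePoint (Function.update k i s))
    (y := latticePoint (Function.update k i u)) (show m ≤ _ from min_le_left _ _)
    (show m ≤ _ from min_le_right _ _) hseg

/-- Summability leaves only finitely many points of the line at or above a given positive value. -/
theorem exists_argmax_line {p : (Fin d → ℤ) → ℝ} (hp0 : ∀ k, 0 ≤ p k) (hp : Summable p)
    (k : Fin d → ℤ) (i : Fin d) :
    ∃ T : ℤ, ∀ t, p (Function.update k i t) ≤ p (Function.update k i T) := by
  have hs : Summable fun t : ℤ => p (Function.update k i t) :=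
    hp.comp_injective (Function.update_injective k i)
  by_cases hz : ∀ t, p (Function.update k i t) = 0
  · exact ⟨0, fun t => by rw [hz, hz]⟩
  push Not at hz
  obtain ⟨t₀, ht₀⟩ := hz
  have hpos : 0 < p (Function.update k i t₀) := lt_of_le_of_ne (hp0 _) ht₀.symm
  have hfin : {t : ℤ | ¬ p (Function.update k i t) < p (Function.update k i t₀)}.Finite :=
    hs.tendsto_cofinite_zero.eventually (gt_mem_nhds hpos)
  obtain ⟨T, hT, hmax⟩ := hfin.exists_maximalFor (fun t => p (Function.update k i t)) _
    ⟨t₀, by simp⟩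
  refine ⟨T, fun t => ?_⟩
  by_cases ht : p (Function.update k i t) < p (Function.update k i t₀)
  · exact ht.le.trans (not_lt.1 hT)
  · rcases le_total (p (Function.update k i t)) (p (Function.update k i T)) with h | h
    · exact h
    · exact hmax ht h

/-- The total variation of a line-quasi-concave function in direction `i` is twice the sum of
its maxima over the lines in this direction. -/
theorem IsLineQuasiConcave.exists_hasSum_variation {p : (Fin d → ℤ) → ℝ}
    (hq : IsLineQuasiConcave p) (hp0 : ∀ k, 0 ≤ p k) (hp : Summable p) (i : Fin d) :
    ∃ T : (Fin d → ℤ) → ℤ, (∀ k t, T (Function.update k i t) = T k) ∧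
      HasSum (fun k => |p (k + Pi.single i 1) - p k|)
        (2 * ∑' k, if k i = T k then p k else 0) := by
  choose T₀ hT₀ using fun k => exists_argmax_line hp0 hp k i
  -- The maximizer must depend only on the line, so it is chosen at the representative with `i`-th
  -- coordinate 0.
  set T : (Fin d → ℤ) → ℤ := fun k => T₀ (Function.update k i 0)
  have hTu : ∀ k t, T (Function.update k i t) = T k := fun k t => by
    simp only [T, Function.update_idem]
  have hT : ∀ k t, p (Function.update k i t) ≤ p (Function.update k i (T k)) := fun k t => by
    have := hT₀ (Function.update k i 0) t
    simpa only [Function.update_idem] using this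
  have hadd : ∀ (k : Fin d → ℤ) t, k + Pi.single i t = Function.update k i (k i + t) :=
    fun k t => by
      funext j
      by_cases hj : j = i
      · subst hj; simp
      · simp [hj]
  -- The sign of the increment: `p` rises up to the maximizer and falls from there on.
  set s : (Fin d → ℤ) → ℝ := fun k => if k i < T k then 1 else -1
  have habs : ∀ k, |p (k + Pi.single i 1) - p k| = s k * p (k + Pi.single i 1) - s k * p k := by
    intro k
    have hk : Function.update k i (k i) = k := Function.update_eq_self i k
    rw [hadd]
    by_cases h : k i < T k
    · have h1 := hq k i (k i) (k i + 1) (T k) (by linarith) (by linarith)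
      have h2 := hT k (k i)
      rw [min_eq_left h2, hk] at h1
      rw [abs_of_nonneg (by linarith)]
      simp only [s, if_pos h, one_mul]
    · have h1 := hq k i (T k) (k i) (k i + 1) (not_lt.1 h) (by linarith)
      rw [min_eq_right (hT k _), hk] at h1
      rw [abs_of_nonpos (by linarith)]
      simp only [s, if_neg h]
      ring
  have hs1 : ∀ k, |s k| ≤ 1 := fun k => by
    simp only [s]; split_ifs <;> simp
  have hsum : ∀ e : Fin d → ℤ, Summable fun k => s (k - e) * p k := fun e => by
    refine Summable.of_abs (hp.of_nonneg_of_le (fun _ => abs_nonneg _) fun k => ?_)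
    rw [abs_mul, abs_of_nonneg (hp0 k)]
    exact mul_le_of_le_one_left (hp0 k) (hs1 _)
  have hshift : HasSum (fun k => s k * p (k + Pi.single i 1))
      (∑' k, s (k - Pi.single i 1) * p k) := by
    have := (Equiv.addRight (Pi.single i 1 : Fin d → ℤ)).hasSum_iff.2 (hsum (Pi.single i 1)).hasSum
    refine this.congr_fun fun k => ?_
    simp
  have h0 : Summable fun k => s k * p k := by simpa using hsum 0
  refine ⟨T, hTu, ?_⟩
  have hfin := hshift.sub h0.hasSum
  rw [← (hsum _).tsum_sub h0] at hfin
  rw [← tsum_mul_left]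
  simp only [habs]
  refine (congrArg (HasSum _) (tsum_congr fun k => ?_)).mpr hfin
  · have hTk : T (k - Pi.single i 1) = T k := by
      rw [sub_eq_add_neg, ← Pi.single_neg, hadd, hTu]
    have hki : (k - Pi.single i 1 : Fin d → ℤ) i = k i - 1 := by simp
    simp only [s, hTk, hki]
    -- After summation by parts the coefficient of `p k` is `s (k - e_i) - s k`, which is 2 at the
    -- maximizer and 0 elsewhere.
    rcases lt_trichotomy (k i) (T k) with h | h | h
    · rw [if_neg h.ne, if_pos h, if_pos (by linarith)]; ring
    · rw [if_pos h, if_neg h.not_lt, if_pos (by linarith)]; ring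
    · rw [if_neg h.ne', if_neg (by linarith), if_neg (by linarith)]; ring

end LineVariation

/-! ### Variation and covariance of mass functions with exponential decay -/

theorem IsLogConcaveExtension.isLineQuasiConcave {d : ℕ} {p : (Fin d → ℤ) → ℝ}
    {f : (Fin d → ℝ) → ℝ} (h : IsLogConcaveExtension p f) : IsLineQuasiConcave p :=
  (funext h.2 : (fun k => f (latticePoint k)) = p) ▸ h.1.isLineQuasiConcave

section DiscreteBounds

variable {d : ℕ} {p : (Fin d → ℤ) → ℝ}

theorem IsLineQuasiConcave.tsum_variation_le (hq : IsLineQuasiConcave p) (hd : 1 ≤ d)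
    {b σ M : ℝ} (hb : 0 < b) (hσ : 1 ≤ σ) (hM : 0 ≤ M) {a : Fin d → ℝ} (hp0 : ∀ k, 0 ≤ p k)
    (hp : ∀ k, p k ≤ M / σ ^ d * Real.exp (-(b * ‖latticePoint k - a‖ / σ))) (i : Fin d) :
    Summable (fun k => |p (k + Pi.single i 1) - p k|) ∧
      ∑' k, |p (k + Pi.single i 1) - p k| ≤ 2 * M * expSumConst d b ^ (d - 1) / σ := by
  classical
  have hσ0 : 0 < σ := by linarith
  have hps : Summable p :=
    ((summable_exp hd hb hσ a).mul_left (M / σ ^ d)).of_nonneg_of_le hp0 hp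
  obtain ⟨T, hT, hsum⟩ := hq.exists_hasSum_variation hp0 hps i
  refine ⟨hsum.summable, ?_⟩
  rw [hsum.tsum_eq]
  have hind : Summable fun k => if k i = T k then p k else 0 :=
    hps.of_nonneg_of_le (fun k => by split_ifs <;> simp [hp0]) fun k => by
      split_ifs <;> simp [hp0]
  have hbound : ∑' k, (if k i = T k then p k else 0) ≤
      M / σ ^ d * (expSumConst d b * σ) ^ (d - 1) := by
    refine hind.tsum_le_of_sum_le fun s => ?_
    rw [← Finset.sum_filter]
    -- The maximizers form a graph over the remaining `d - 1` coordinates.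
    have hinj : Set.InjOn (fun k : Fin d → ℤ => fun j : {j // j ≠ i} => k j)
        (s.filter fun k => k i = T k : Finset (Fin d → ℤ)) := by
      intro k hk k' hk' h
      have hk1 : k i = T k := (Finset.mem_filter.1 hk).2
      have hk2 : k' i = T k' := (Finset.mem_filter.1 hk').2
      have hu : Function.update k i 0 = Function.update k' i 0 := by
        funext j
        by_cases hj : j = i
        · subst hj; simp
        · rw [Function.update_of_ne hj, Function.update_of_ne hj]
          exact congrFun h ⟨j, hj⟩
      have hTk : T k = T k' := by rw [← hT k 0, hu, hT]
      funext j
      by_cases hj : j = i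
      · subst hj; rw [hk1, hk2, hTk]
      · exact congrFun h ⟨j, hj⟩
    have hcard : Fintype.card {j // j ≠ i} = d - 1 := by simp
    have := sum_exp_le_of_injOn (ι := {j // j ≠ i}) (e := Subtype.val) (by rw [hcard]; omega) hd
      hb hσ a _ hinj
    rw [hcard] at this
    calc _ ≤ ∑ k ∈ s.filter fun k => k i = T k,
          M / σ ^ d * Real.exp (-(b * ‖latticePoint k - a‖ / σ)) :=
          Finset.sum_le_sum fun k _ => hp k
      _ ≤ _ := by
        rw [← Finset.mul_sum]
        exact mul_le_mul_of_nonneg_left this (by positivity)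
  calc _ ≤ 2 * (M / σ ^ d * (expSumConst d b * σ) ^ (d - 1)) := by linarith
    _ = _ := by
      obtain ⟨m, rfl⟩ : ∃ m, d = m + 1 := ⟨d - 1, by omega⟩
      rw [Nat.add_sub_cancel, mul_pow, pow_succ]
      field_simp

/-! ### Covariance of a mass function on the lattice. -/

section Covariance

variable (hp1 : HasSum p 1) {a : Fin d → ℝ}
  (hs1 : ∀ i, Summable fun k => (latticePoint k - a) i * p k)
  (hs2 : ∀ i j, Summable fun k => (latticePoint k - a) i * (latticePoint k - a) j * p k)

include hp1 hs1 hs2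

/-- Covariance is translation invariant; moments about the centre `a` of the decay are the ones of
controlled size. -/
theorem covInt_eq_sub (i j : Fin d) :
    covInt p i j = ∑' k, (latticePoint k - a) i * (latticePoint k - a) j * p k -
      (∑' k, (latticePoint k - a) i * p k) * ∑' k, (latticePoint k - a) j * p k := by
  set Y : Fin d → ℝ := fun i => ∑' k, (latticePoint k - a) i * p k
  have h1 : ∀ i, HasSum (fun k : Fin d → ℤ => (k i : ℝ) * p k) (Y i + a i * 1) := fun i =>
    ((hs1 i).hasSum.add (hp1.mul_left (a i))).congr_fun fun k => by
      simp only [latticePoint, Pi.sub_apply]; ring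
  have h2 : HasSum (fun k : Fin d → ℤ => (k i : ℝ) * k j * p k)
      (∑' k, (latticePoint k - a) i * (latticePoint k - a) j * p k + a i * Y j + a j * Y i +
        a i * a j * 1) :=
    ((((hs2 i j).hasSum.add ((hs1 j).hasSum.mul_left (a i))).add
      ((hs1 i).hasSum.mul_left (a j))).add (hp1.mul_left (a i * a j))).congr_fun fun k => by
        simp only [latticePoint, Pi.sub_apply]; ring
  rw [covInt, Matrix.of_apply, h2.tsum_eq, (h1 i).tsum_eq, (h1 j).tsum_eq, hp1.tsum_eq]
  ring

theorem hasSum_sq_sub_mean (θ : Fin d → ℝ) :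
    ∃ m : ℝ, HasSum (fun k => (∑ i, θ i * (latticePoint k - a) i - m) ^ 2 * p k)
      (∑ i, ∑ j, θ i * θ j * covInt p i j) := by
  set Y : Fin d → ℝ := fun i => ∑' k, (latticePoint k - a) i * p k
  set m := ∑ i, θ i * Y i with hm
  refine ⟨m, ?_⟩
  have h1 : HasSum (fun k => ∑ i, θ i * ((latticePoint k - a) i * p k)) m :=
    hasSum_sum fun i _ => (hs1 i).hasSum.mul_left (θ i)
  have h2 : HasSum (fun k => ∑ i, ∑ j, θ i * θ j *
      ((latticePoint k - a) i * (latticePoint k - a) j * p k))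
      (∑ i, ∑ j, θ i * θ j * ∑' k, (latticePoint k - a) i * (latticePoint k - a) j * p k) :=
    hasSum_sum fun i _ => hasSum_sum fun j _ => (hs2 i j).hasSum.mul_left (θ i * θ j)
  have h3 := (h2.add (h1.mul_left (-2 * m))).add (hp1.mul_left (m ^ 2))
  have hval : ∑ i, ∑ j, θ i * θ j * covInt p i j =
      ∑ i, ∑ j, θ i * θ j * ∑' k, (latticePoint k - a) i * (latticePoint k - a) j * p k +
        -2 * m * m + m ^ 2 * 1 := by
    have hmm : ∑ i, ∑ j, θ i * θ j * (Y i * Y j) = m * m := by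
      rw [hm, Finset.sum_mul_sum]
      exact Finset.sum_congr rfl fun i _ => Finset.sum_congr rfl fun j _ => by ring
    simp only [covInt_eq_sub hp1 hs1 hs2, mul_sub, Finset.sum_sub_distrib]
    rw [hmm]
    ring
  rw [hval]
  refine h3.congr_fun fun k => ?_
  have k1 : ∑ i, θ i * ((latticePoint k - a) i * p k) =
      (∑ i, θ i * (latticePoint k - a) i) * p k := by
    rw [Finset.sum_mul]; exact Finset.sum_congr rfl fun i _ => by ring
  have k2 : ∑ i, ∑ j, θ i * θ j * ((latticePoint k - a) i * (latticePoint k - a) j * p k) =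
      (∑ i, θ i * (latticePoint k - a) i) * (∑ j, θ j * (latticePoint k - a) j) * p k := by
    rw [Finset.sum_mul_sum, Finset.sum_mul]
    refine Finset.sum_congr rfl fun i _ => ?_
    rw [Finset.sum_mul]
    exact Finset.sum_congr rfl fun j _ => by ring
  rw [k1, k2]
  ring

/-- A linear form of zero variance is constant on the support, but `k₀` and `k₀ + e_i` give values
differing by `θ i`. So the covariance is positive definite. -/
theorem det_covInt_pos (hp0 : ∀ k, 0 ≤ p k) {k₀ : Fin d → ℤ} (hk₀ : 0 < p k₀)
    (hk : ∀ i, 0 < p (k₀ + Pi.single i 1)) : 0 < (covInt p).det := by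
  have hsymm : (covInt p).IsHermitian := by
    ext i j
    simp only [Matrix.conjTranspose_apply, star_trivial, covInt, Matrix.of_apply]
    rw [mul_comm (∑' k : Fin d → ℤ, (k j : ℝ) * p k)]
    simp only [mul_comm ((_ : ℤ) : ℝ) ((_ : ℤ) : ℝ)]
  refine (Matrix.PosDef.of_dotProduct_mulVec_pos hsymm fun θ hθ => ?_).det_pos
  obtain ⟨m, hm⟩ := hasSum_sq_sub_mean hp1 hs1 hs2 θ
  have hval : star θ ⬝ᵥ (covInt p).mulVec θ = ∑ i, ∑ j, θ i * θ j * covInt p i j := by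
    simp only [star_trivial, dotProduct, Matrix.mulVec, Finset.mul_sum]
    exact Finset.sum_congr rfl fun i _ => Finset.sum_congr rfl fun j _ => by ring
  rw [hval, ← hm.tsum_eq]
  obtain ⟨i, hi⟩ := Function.ne_iff.1 hθ
  have h0 : ∀ k, 0 ≤ (∑ i, θ i * (latticePoint k - a) i - m) ^ 2 * p k := fun k =>
    mul_nonneg (sq_nonneg _) (hp0 k)
  have hstep : ∑ l, θ l * (latticePoint (k₀ + Pi.single i 1) - a : Fin d → ℝ) l =
      ∑ l, θ l * (latticePoint k₀ - a) l + θ i := by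
    have : ∀ l, θ l * (latticePoint (k₀ + Pi.single i 1) - a : Fin d → ℝ) l =
        θ l * (latticePoint k₀ - a) l + if l = i then θ l else 0 := fun l => by
      by_cases hl : l = i
      · subst hl; simp [latticePoint]; ring
      · simp [latticePoint, hl]
    simp only [this, Finset.sum_add_distrib, Finset.sum_ite_eq', Finset.mem_univ, if_true]
  by_cases hc : ∑ l, θ l * (latticePoint k₀ - a) l - m = 0
  · refine hm.summable.tsum_pos h0 (k₀ + Pi.single i 1) (mul_pos ?_ (hk i))
    rw [hstep, add_sub_right_comm, hc, zero_add]
    exact sq_pos_of_ne_zero hi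
  · exact hm.summable.tsum_pos h0 k₀ (mul_pos (by positivity) hk₀)

end Covariance

/-- Counting lattice points in a cube on which `p` is bounded below. -/
theorem le_of_forall_norm_sub_le (hp1 : HasSum p 1) (hp0 : ∀ k, 0 ≤ p k) {x G : ℝ} (hx : 1 ≤ x)
    (hG : 0 ≤ G) {z : Fin d → ℝ} (hp : ∀ k, ‖latticePoint k - z‖ ≤ x → G ≤ p k) :
    G ≤ 2 ^ d / x ^ d := by
  have hx0 : 0 < x := by linarith
  set m := ⌊x⌋₊
  have hm : x / 2 ≤ m := by
    have h1 : (1 : ℝ) ≤ m := by exact_mod_cast Nat.one_le_floor_iff x |>.2 hx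
    have h2 := Nat.lt_floor_add_one x
    change x < m + 1 at h2
    linarith
  have hmx : (m : ℝ) ≤ x := Nat.floor_le hx0.le
  set B : Finset (Fin d → ℤ) := Fintype.piFinset fun i => Finset.Ico ⌊z i⌋ (⌊z i⌋ + m)
  have hcard : (B.card : ℝ) = m ^ d := by
    simp [B, Fintype.card_piFinset]
  have hB : ∀ k ∈ B, G ≤ p k := fun k hk => hp k <| by
    rw [pi_norm_le_iff_of_nonneg hx0.le]
    intro i
    have h := Finset.mem_Ico.1 (Fintype.mem_piFinset.1 hk i)
    have h1 : ((⌊z i⌋ : ℤ) : ℝ) ≤ k i := by exact_mod_cast h.1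
    have h2 : (k i : ℝ) + 1 ≤ ⌊z i⌋ + m := by exact_mod_cast h.2
    rw [Real.norm_eq_abs, abs_le]
    simp only [latticePoint, Pi.sub_apply]
    constructor <;> linarith [Int.floor_le (z i), Int.lt_floor_add_one (z i)]
  have h1 : B.card * G ≤ 1 := by
    calc B.card * G = ∑ _k ∈ B, G := by simp
      _ ≤ ∑ k ∈ B, p k := Finset.sum_le_sum hB
      _ ≤ ∑' k, p k := hp1.summable.sum_le_tsum _ fun k _ => hp0 k
      _ = 1 := hp1.tsum_eq
  rw [hcard] at h1
  have h2 : (x / 2) ^ d * G ≤ 1 :=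
    (mul_le_mul_of_nonneg_right (pow_le_pow_left₀ (by positivity) hm d) hG).trans h1
  rw [le_div_iff₀ (by positivity)]
  rw [div_pow, div_mul_eq_mul_div, div_le_one (by positivity)] at h2
  linarith

/-- Main estimates for a log-concave mass function in terms of the scale of its extension. -/
theorem IsLogConcaveExtension.exists_estimates (d : ℕ) (hd : 1 ≤ d) :
    ∃ V L : ℝ, 0 < L ∧ 0 ≤ V ∧ ∃ N ≥ 1, ∀ (p : (Fin d → ℤ) → ℝ) (f : (Fin d → ℝ) → ℝ),
      HasSum p 1 → IsLogConcaveExtension p f → Integrable f → 0 < ∫ x, f x →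
      N ≤ detScale (covReal f) → (∀ i, covReal f i i ≤ 2 * detScale (covReal f) ^ 2) →
      0 < (covInt p).det ∧ detScale (covInt p) ≤ L * detScale (covReal f) ∧
        ∀ i, Summable (fun k => |p (k + Pi.single i 1) - p k|) ∧
          ∑' k, |p (k + Pi.single i 1) - p k| ≤ V / detScale (covReal f) := by
  have hd' : (0 : ℝ) < d := by exact_mod_cast hd
  obtain ⟨b, hb, r, hr, hgeom⟩ := IsLogConcave.exists_exp_bounds d hd
  -- Here `32 = 8 * 4`, from `f ≤ 8F` and the counting bound on `F/4`.
  set M : ℝ := 32 * (2 ^ d / r ^ d)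
  have hM : 0 < M := by positivity
  set A := expSumConst d (b / 2)
  have hA : 0 < A := expSumConst_pos (by positivity)
  set c : ℕ → ℝ := fun n => M * (n.factorial * (2 / b) ^ n) * A ^ d with hc
  have hc0 : ∀ n, 0 < c n := fun n => by simp only [hc]; positivity
  set Q := c 2 + c 1 * c 1 with hQ
  have hQ0 : 0 < Q := by have := hc0 2; have := hc0 1; positivity
  refine ⟨2 * M * expSumConst d b ^ (d - 1), (d.factorial * Q ^ d) ^ (1 / (2 * (d : ℝ))),
    by positivity, by have := expSumConst_pos (d := d) hb; positivity, max 1 (1 / r), le_max_left _ _,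
    fun p f hp1 hpf hi hpos hN hdiag => ?_⟩
  set σ := detScale (covReal f)
  have hσ : 1 ≤ σ := (le_max_left _ _).trans hN
  have hσ0 : 0 < σ := by linarith
  -- The plateau then has radius at least 1, so it contains `⌊z⌋` and all its neighbours `⌊z⌋ +
  -- e_i`.
  have hrσ : 1 ≤ r * σ := by
    have := (le_max_right _ _).trans hN
    rwa [div_le_iff₀' hr] at this
  obtain ⟨F, hF, a, z, hup, hlow⟩ := hgeom f hpf.1 hi hpos hσ0 hdiag
  have hp0 : ∀ k, 0 ≤ p k := fun k => hpf.2 k ▸ hpf.1.1 _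
  have hplow : ∀ k, ‖latticePoint k - z‖ ≤ r * σ → F / 4 ≤ p k := fun k hk =>
    hpf.2 k ▸ hlow _ hk
  have hFle := le_of_forall_norm_sub_le hp1 hp0 hrσ (by positivity) hplow
  have hpup : ∀ k, p k ≤ M / σ ^ d * Real.exp (-(b * ‖latticePoint k - a‖ / σ)) := fun k => by
    rw [← hpf.2 k]
    refine (hup _).trans (mul_le_mul_of_nonneg_right ?_ (Real.exp_pos _).le)
    calc 8 * F = 32 * (F / 4) := by ring
      _ ≤ 32 * (2 ^ d / (r * σ) ^ d) := by linarith
      _ = M / σ ^ d := by simp only [M, mul_pow]; field_simp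
  have hmom := fun n (φ : (Fin d → ℤ) → ℝ) (hφ : ∀ k, |φ k| ≤ ‖latticePoint k - a‖ ^ n) =>
    summable_mul_and_abs_tsum_le hd hb hσ hM.le hp0 hpup n hφ
  have hm1 := fun i => hmom 1 (fun k => (latticePoint k - a) i) fun k =>
    IsNormalized.abs_coord_le i _
  have hm2 := fun i j => hmom 2 (fun k => (latticePoint k - a) i * (latticePoint k - a) j)
    fun k => IsNormalized.abs_coord_mul_le i j _
  have hcov : ∀ i j, |covInt p i j| ≤ Q * σ ^ 2 := fun i j => by
    rw [covInt_eq_sub hp1 (fun i => (hm1 i).1) (fun i j => (hm2 i j).1)]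
    refine (abs_sub _ _).trans ?_
    rw [hQ, add_mul]
    refine add_le_add (hm2 i j).2 ?_
    rw [abs_mul]
    calc _ ≤ (c 1 * σ ^ 1) * (c 1 * σ ^ 1) :=
          mul_le_mul (hm1 i).2 (hm1 j).2 (abs_nonneg _) (by have := hc0 1; positivity)
      _ = _ := by ring
  have hdet : 0 < (covInt p).det := by
    set k₀ : Fin d → ℤ := fun i => ⌊z i⌋
    refine det_covInt_pos hp1 (fun i => (hm1 i).1) (fun i j => (hm2 i j).1) hp0 (k₀ := k₀) ?_
      fun i => ?_
    · refine lt_of_lt_of_le (by positivity) (hplow k₀ ?_)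
      refine le_trans ?_ hrσ
      rw [pi_norm_le_iff_of_nonneg zero_le_one]
      intro j
      rw [Real.norm_eq_abs, abs_le]
      simp only [latticePoint, Pi.sub_apply, k₀]
      constructor <;> linarith [Int.floor_le (z j), Int.lt_floor_add_one (z j)]
    · refine lt_of_lt_of_le (by positivity) (hplow _ ?_)
      refine le_trans ?_ hrσ
      rw [pi_norm_le_iff_of_nonneg zero_le_one]
      intro j
      rw [Real.norm_eq_abs, abs_le]
      by_cases hj : j = i
      · subst hj
        simp only [latticePoint, Pi.sub_apply, Pi.add_apply, Pi.single_eq_same, k₀]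
        push_cast
        constructor <;> linarith [Int.floor_le (z j), Int.lt_floor_add_one (z j)]
      · simp only [latticePoint, Pi.sub_apply, Pi.add_apply, Pi.single_eq_of_ne hj, k₀, add_zero]
        constructor <;> linarith [Int.floor_le (z j), Int.lt_floor_add_one (z j)]
  refine ⟨hdet, ?_, hpf.isLineQuasiConcave.tsum_variation_le hd hb hσ hM.le hp0 hpup⟩
  have h1 := abs_det_le_of_abs_le hcov
  rw [abs_of_pos hdet] at h1
  calc detScale (covInt p) ≤ (d.factorial * (Q * σ ^ 2) ^ d) ^ (1 / (2 * (d : ℝ))) :=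
        Real.rpow_le_rpow hdet.le h1 (by positivity)
    _ = (d.factorial * Q ^ d * σ ^ (2 * d)) ^ (1 / (2 * (d : ℝ))) := by
        rw [mul_pow, ← pow_mul, mul_assoc]
    _ = _ := by
        rw [Real.mul_rpow (by positivity) (by positivity), ← Real.rpow_natCast σ,
          ← Real.rpow_mul hσ0.le]
        push_cast
        rw [mul_one_div_cancel (by positivity), Real.rpow_one]

end DiscreteBounds

/-! ### Variation under lattice translations -/

section Translations

variable {d : ℕ}

/-- The `ℓ¹` distance between `p` and its translate by `j` is finite and at most `c`. -/
def TranslateBound (p : (Fin d → ℤ) → ℝ) (j : Fin d → ℤ) (c : ℝ) : Prop :=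
  Summable (fun k => |p (k + j) - p k|) ∧ ∑' k, |p (k + j) - p k| ≤ c

variable {p : (Fin d → ℤ) → ℝ} {j j' : Fin d → ℤ} {c c' : ℝ}

theorem TranslateBound.zero : TranslateBound p 0 0 := by
  simp [TranslateBound, summable_zero]

theorem TranslateBound.add (h : TranslateBound p j c) (h' : TranslateBound p j' c') :
    TranslateBound p (j + j') (c + c') := by
  have hs : Summable fun k => |p (k + j + j') - p (k + j)| :=
    h'.1.comp_injective (add_left_injective j)
  have ht : ∑' k, |p (k + j + j') - p (k + j)| = ∑' k, |p (k + j') - p k| :=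
    (Equiv.addRight j).tsum_eq fun k => |p (k + j') - p k|
  have hle : ∀ k, |p (k + (j + j')) - p k| ≤ |p (k + j) - p k| + |p (k + j + j') - p (k + j)| :=
    fun k => by
      rw [← add_assoc, add_comm |p (k + j) - p k|]
      exact abs_sub_le _ _ _
  have hs' := (h.1.add hs).of_nonneg_of_le (fun _ => abs_nonneg _) hle
  refine ⟨hs', (hs'.tsum_le_tsum hle (h.1.add hs)).trans ?_⟩
  rw [h.1.tsum_add hs, ht]
  exact add_le_add h.2 h'.2

theorem TranslateBound.neg (h : TranslateBound p j c) : TranslateBound p (-j) c := by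
  have e : (fun k => |p (k + -j) - p k|) = (fun k => |p (k + j) - p k|) ∘ Equiv.addRight (-j) := by
    funext k
    simp [abs_sub_comm]
  rw [TranslateBound, e]
  refine ⟨(Equiv.summable_iff _).2 h.1, ?_⟩
  exact ((Equiv.addRight (-j)).tsum_eq fun k => |p (k + j) - p k|).trans_le h.2

theorem TranslateBound.nsmul (h : TranslateBound p j c) (n : ℕ) :
    TranslateBound p (n • j) (n * c) := by
  induction n with
  | zero => simpa using TranslateBound.zero
  | succ n ih =>
    rw [succ_nsmul]
    push_cast
    rw [add_one_mul]
    exact ih.add h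

theorem TranslateBound.zsmul (h : TranslateBound p j c) (t : ℤ) :
    TranslateBound p (t • j) (|(t : ℝ)| * c) := by
  obtain ⟨n, rfl | rfl⟩ := t.eq_nat_or_neg
  · simpa using h.nsmul n
  · simpa using (h.nsmul n).neg

theorem TranslateBound.sum {ι : Type*} (s : Finset ι) {J : ι → Fin d → ℤ} {C : ι → ℝ}
    (h : ∀ i, TranslateBound p (J i) (C i)) :
    TranslateBound p (∑ i ∈ s, J i) (∑ i ∈ s, C i) := by
  classical
  induction s using Finset.induction_on with
  | empty => simpa using TranslateBound.zero
  | insert i s hi ih =>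
    rw [Finset.sum_insert hi, Finset.sum_insert hi]
    exact (h i).add ih

theorem translateBound_of_single {V : ℝ} (h : ∀ i, TranslateBound p (Pi.single i 1) V)
    (j : Fin d → ℤ) : TranslateBound p j ((∑ i, |(j i : ℝ)|) * V) := by
  have e : j = ∑ i, j i • (Pi.single i 1 : Fin d → ℤ) := by
    funext l
    simp [Finset.sum_apply, Pi.single_apply]
  have := TranslateBound.sum Finset.univ fun i => (h i).zsmul (j i)
  rw [← e, ← Finset.sum_mul] at this
  exact this

/-- The sum of `ℓ¹` norms of the elements of a finite set of translations. -/
noncomputable def totalLength (B : Finset (Fin d → ℤ)) : ℝ := ∑ j ∈ B, ∑ i, |(j i : ℝ)|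

theorem hasSum_box_variation {V : ℝ} (h : ∀ i, TranslateBound p (Pi.single i 1) V)
    (B : Finset (Fin d → ℤ)) :
    Summable (fun k => ∑ j ∈ B, |p (k + j) - p k|) ∧
      ∑' k, ∑ j ∈ B, |p (k + j) - p k| ≤ totalLength B * V := by
  have hj := translateBound_of_single h
  refine ⟨summable_sum fun j _ => (hj j).1, ?_⟩
  rw [Summable.tsum_finsetSum fun j _ => (hj j).1, totalLength, Finset.sum_mul]
  exact Finset.sum_le_sum fun j _ => (hj j).2

end Translations

/-! ### The smoothed density as an average of translates -/

section Smoothing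

variable {d : ℕ}

theorem measurable_floor_pi : Measurable fun x : Fin d → ℝ => fun i => ⌊x i⌋ :=
  measurable_pi_lambda _ fun i => Int.measurable_floor.comp (measurable_pi_apply i)

theorem cubeAt_eq_pi (k : Fin d → ℤ) :
    cubeAt k = Set.pi Set.univ fun i => Set.Ico (k i : ℝ) ((k i : ℝ) + 1) := by
  ext x
  simp [cubeAt]

theorem measurableSet_cubeAt (k : Fin d → ℤ) : MeasurableSet (cubeAt k) := by
  rw [cubeAt_eq_pi]
  exact MeasurableSet.univ_pi fun i => measurableSet_Ico

theorem volume_cubeAt (k : Fin d → ℤ) : volume (cubeAt k) = 1 := by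
  rw [cubeAt_eq_pi, Real.volume_pi_Ico]
  simp

/-- `ν` is the law of a sum of `n` uniform vectors. The index is `n + 1` because `f_1` already
contains one of them. -/
theorem exists_averaging (n : ℕ) :
    ∃ ν : Measure (Fin d → ℝ), IsProbabilityMeasure ν ∧
      (∀ᵐ w ∂ν, ∀ i : Fin d, (0 : ℝ) ≤ w i ∧ w i ≤ (n : ℝ)) ∧
      ∀ p : (Fin d → ℤ) → ℝ, (∀ k, 0 ≤ p k) → (∀ k, p k ≤ 1) →
        ∀ x, smoothedDensity p (n + 1) x = ∫ w, p (fun i => ⌊(x - w) i⌋) ∂ν := by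
  induction n with
  | zero =>
    refine ⟨Measure.dirac 0, inferInstance, ?_, fun p _ _ x => ?_⟩
    · rw [ae_dirac_eq]
      simp
    · rw [integral_dirac]
      simp [smoothedDensity]
  | succ n ih =>
    obtain ⟨ν, hν, hsupp, hint⟩ := ih
    set lam : Measure (Fin d → ℝ) := volume.restrict (cubeAt 0)
    have hlam : IsProbabilityMeasure lam := ⟨by
      rw [Measure.restrict_apply_univ, volume_cubeAt]⟩
    have hlam_supp : ∀ᵐ u ∂lam, u ∈ cubeAt (0 : Fin d → ℤ) :=
      ae_restrict_mem (measurableSet_cubeAt 0)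
    refine ⟨lam.conv ν, inferInstance, ?_, fun p hp0 hp1 x => ?_⟩
    · have hm : MeasurableSet {w : Fin d → ℝ | ∀ i, 0 ≤ w i ∧ w i ≤ ((n + 1 : ℕ) : ℝ)} := by
        have : {w : Fin d → ℝ | ∀ i, 0 ≤ w i ∧ w i ≤ ((n + 1 : ℕ) : ℝ)} =
            Set.pi Set.univ fun _ => Set.Icc 0 ((n + 1 : ℕ) : ℝ) := by
          ext w
          simp only [Set.mem_ofPred_eq, Set.mem_pi, Set.mem_univ, true_implies, Set.mem_Icc]
        rw [this]
        exact MeasurableSet.univ_pi fun _ => measurableSet_Icc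
      rw [Measure.conv, ae_map_iff (by fun_prop) hm]
      filter_upwards [Measure.quasiMeasurePreserving_fst.ae hlam_supp,
        Measure.quasiMeasurePreserving_snd.ae hsupp] with z h1 h2 i
      have h3 := h1 i
      have h4 := h2 i
      simp only [Pi.zero_apply, Int.cast_zero, zero_add] at h3
      rw [Pi.add_apply]
      push_cast
      constructor <;> linarith [h3.1, h3.2, h4.1, h4.2]
    · have hmeas : Measurable fun z : Fin d → ℝ => p fun i => ⌊(x - z) i⌋ :=
        (measurable_of_countable p).comp (measurable_floor_pi.comp (by fun_prop))
      have hbint : Integrable (fun z : Fin d → ℝ => p fun i => ⌊(x - z) i⌋) (lam.conv ν) :=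
        Integrable.of_bound hmeas.aestronglyMeasurable 1 (ae_of_all _ fun z => by
          rw [Real.norm_of_nonneg (hp0 _)]; exact hp1 _)
      rw [integral_conv hbint]
      show ∫ u in cubeAt (0 : Fin d → ℤ), smoothedDensity p (n + 1) (x - u) = _
      refine integral_congr_ae (ae_of_all _ fun u => ?_)
      simp only [hint p hp0 hp1, sub_sub]

variable {p : (Fin d → ℤ) → ℝ}

/-- All lattice translates of `q` have the same sum, so averaging over a random translation
preserves it, by Fubini. -/
theorem hasSum_integral_translate {ν : Measure (Fin d → ℝ)} [IsProbabilityMeasure ν]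
    {q : (Fin d → ℤ) → ℝ} {Q : ℝ} (hq0 : ∀ k, 0 ≤ q k) (hq : HasSum q Q)
    {m : (Fin d → ℝ) → Fin d → ℤ} (hm : Measurable m) :
    (∀ k, Integrable (fun w => q (k + m w)) ν) ∧ HasSum (fun k => ∫ w, q (k + m w) ∂ν) Q := by
  have htr : ∀ e, HasSum (fun k => q (k + e)) Q := fun e => (Equiv.addRight e).hasSum_iff.2 hq
  have hint : ∀ k, Integrable (fun w => q (k + m w)) ν := fun k => by
    refine Integrable.of_bound (((measurable_of_countable q).comp
      (hm.const_add k)).aestronglyMeasurable) Q (ae_of_all _ fun w => ?_)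
    rw [Real.norm_of_nonneg (hq0 _)]
    exact le_hasSum hq _ fun k _ => hq0 k
  refine ⟨hint, ?_⟩
  have hnorm : ∀ k, ∫ w, ‖q (k + m w)‖ ∂ν = ∫ w, q (k + m w) ∂ν := fun k => by
    simp only [Real.norm_of_nonneg (hq0 _)]
  have hsum : Summable fun k => ∫ w, ‖q (k + m w)‖ ∂ν := by
    simp only [hnorm]
    refine summable_of_sum_le (c := Q) (fun k => integral_nonneg fun _ => hq0 _) fun s => ?_
    rw [← integral_finsetSum _ fun k _ => hint k]
    calc _ ≤ ∫ _w, Q ∂ν := integral_mono (integrable_finsetSum _ fun k _ => hint k)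
          (integrable_const _) fun w => sum_le_hasSum s (fun k _ => hq0 _) (htr (m w))
      _ = Q := by simp
  have h := hasSum_integral_of_summable_integral_norm hint hsum
  simp only [(htr _).tsum_eq] at h
  simpa using h

theorem latticePoint_mem_cubeAt (k : Fin d → ℤ) : latticePoint k ∈ cubeAt k := fun i => by
  simp [latticePoint]

/-- The bounds for the errors `g_n(k, ·)` in terms of the total variation of the mass function. -/
theorem densityError_bounds (hp0 : ∀ k, 0 ≤ p k) (hp : HasSum p 1) {V : ℝ}
    (hV : ∀ i, TranslateBound p (Pi.single i 1) V) (n : ℕ) :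
    (∀ k, BddAbove ((fun x => |densityError p (n + 1) k x|) '' cubeAt k)) ∧
      Summable (fun k => sSup (densityError p (n + 1) k '' cubeAt k)) ∧
      |∑' k, sSup (densityError p (n + 1) k '' cubeAt k)| ≤
        totalLength (Finset.Icc (0 : Fin d → ℤ) 1) * V ∧
      Summable (fun k => sSup ((fun x => |densityError p (n + 1) k x|) '' cubeAt k)) ∧
      ∑' k, sSup ((fun x => |densityError p (n + 1) k x|) '' cubeAt k) ≤
        totalLength (Finset.Icc (fun _ : Fin d => -(n : ℤ)) 0) * V := by
  have hp1 : ∀ k, p k ≤ 1 := fun k => le_hasSum hp k fun j _ => hp0 j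
  obtain ⟨ν, hν, hsupp, hint⟩ := exists_averaging (d := d) n
  have hfn := hint p hp0 hp1
  have hfl : ∀ x : Fin d → ℝ, Integrable (fun w => p fun i => ⌊(x - w) i⌋) ν := fun x =>
    Integrable.of_bound ((measurable_of_countable p).comp
      (measurable_floor_pi.comp (by fun_prop))).aestronglyMeasurable 1 (ae_of_all _ fun z => by
        rw [Real.norm_of_nonneg (hp0 _)]; exact hp1 _)
  set B := Finset.Icc (fun _ : Fin d => -(n : ℤ)) 0
  set E : (Fin d → ℤ) → ℝ := fun k => ∑ j ∈ B, |p (k + j) - p k|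
  have hE : ∀ k, ∀ x ∈ cubeAt k, |densityError p (n + 1) k x| ≤ E k := by
    intro k x hx
    have h1 : densityError p (n + 1) k x = ∫ w, (p (fun i => ⌊(x - w) i⌋) - p k) ∂ν := by
      rw [densityError, hfn, integral_sub (hfl x) (integrable_const _)]
      simp
    rw [h1, ← Real.norm_eq_abs]
    have h2 : ∫ _w, E k ∂ν = E k := by simp
    rw [← h2]
    refine norm_integral_le_of_norm_le (integrable_const _) ?_
    filter_upwards [hsupp] with w hw
    -- Each coordinate of `w` is in `[0,n]` and each of `x - k` in `[0,1)`, so the displacement lies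
    -- in `[-n,0]^d`.
    have hmem : (fun i => ⌊(x - w) i⌋ - k i) ∈ B := by
      rw [Finset.mem_Icc]
      constructor
      · intro i
        have : k i - (n : ℤ) ≤ ⌊(x - w) i⌋ := by
          rw [Int.le_floor, Pi.sub_apply]
          push_cast
          linarith [(hx i).1, (hw i).2]
        show -(n : ℤ) ≤ ⌊(x - w) i⌋ - k i
        linarith
      · intro i
        have : ⌊(x - w) i⌋ < k i + 1 := by
          rw [Int.floor_lt, Pi.sub_apply]
          push_cast
          linarith [(hx i).2, (hw i).1]
        show ⌊(x - w) i⌋ - k i ≤ 0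
        linarith
    have h3 := Finset.single_le_sum (f := fun j => |p (k + j) - p k|)
      (fun j _ => abs_nonneg _) hmem
    have h4 : k + (fun i => ⌊(x - w) i⌋ - k i) = fun i => ⌊(x - w) i⌋ := by
      funext i; simp
    rw [Real.norm_eq_abs]
    simp only [h4] at h3
    exact h3
  obtain ⟨hEs, hEt⟩ := hasSum_box_variation hV B
  have hne : ∀ k : Fin d → ℤ, (cubeAt k).Nonempty := fun k => ⟨_, latticePoint_mem_cubeAt k⟩
  have hbdd : ∀ k, BddAbove ((fun x => |densityError p (n + 1) k x|) '' cubeAt k) := fun k =>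
    ⟨E k, by rintro _ ⟨x, hx, rfl⟩; exact hE k x hx⟩
  have hbdd' : ∀ k, BddAbove (densityError p (n + 1) k '' cubeAt k) := fun k =>
    ⟨E k, by rintro _ ⟨x, hx, rfl⟩; exact (le_abs_self _).trans (hE k x hx)⟩
  have habs_le : ∀ k, sSup ((fun x => |densityError p (n + 1) k x|) '' cubeAt k) ≤ E k := fun k =>
    csSup_le ((hne k).image _) (by rintro _ ⟨x, hx, rfl⟩; exact hE k x hx)
  have habs_nonneg : ∀ k, 0 ≤ sSup ((fun x => |densityError p (n + 1) k x|) '' cubeAt k) :=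
    fun k => Real.sSup_nonneg (by rintro _ ⟨x, _, rfl⟩; exact abs_nonneg _)
  have habs_sum := hEs.of_nonneg_of_le habs_nonneg habs_le
  -- With reference point `k + ⌊-w⌋` in place of `k`, the displacement of `⌊x - w⌋` lies in
  -- `{0,1}^d` whatever `n` is.
  set m : (Fin d → ℝ) → Fin d → ℤ := fun w i => ⌊(-w) i⌋
  have hm : Measurable m := measurable_floor_pi.comp measurable_neg
  set D : (Fin d → ℤ) → ℝ := fun k => ∑ j ∈ Finset.Icc (0 : Fin d → ℤ) 1, |p (k + j) - p k|
  have hD0 : ∀ k, 0 ≤ D k := fun k => Finset.sum_nonneg fun _ _ => abs_nonneg _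
  obtain ⟨hDs, hDt⟩ := hasSum_box_variation hV (Finset.Icc (0 : Fin d → ℤ) 1)
  obtain ⟨ha_int, ha⟩ := hasSum_integral_translate (ν := ν) hp0 hp hm
  obtain ⟨hb_int, hb⟩ := hasSum_integral_translate (ν := ν) hD0 hDs.hasSum hm
  -- The supremum is at least the value at the corner `x = k`, where the displacement is zero.
  have hlow : ∀ k, ∫ w, p (k + m w) ∂ν - p k ≤ sSup (densityError p (n + 1) k '' cubeAt k) :=
    fun k => by
      refine le_csSup (hbdd' k) ⟨latticePoint k, latticePoint_mem_cubeAt k, ?_⟩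
      rw [densityError, hfn]
      congr 2
      funext w
      congr 1
      funext i
      simp only [latticePoint, Pi.sub_apply, Pi.add_apply, m, Pi.neg_apply]
      rw [sub_eq_add_neg, Int.floor_intCast_add]
  have hup : ∀ k, sSup (densityError p (n + 1) k '' cubeAt k) ≤
      ∫ w, p (k + m w) ∂ν + ∫ w, D (k + m w) ∂ν - p k := fun k => by
    refine csSup_le ((hne k).image _) ?_
    rintro _ ⟨x, hx, rfl⟩
    rw [densityError, hfn, ← integral_add (ha_int k) (hb_int k)]
    refine sub_le_sub_right (integral_mono (hfl x) ((ha_int k).add (hb_int k)) fun w => ?_) _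
    have hmem : (fun i => ⌊(x - w) i⌋ - (k + m w) i) ∈ Finset.Icc (0 : Fin d → ℤ) 1 := by
      rw [Finset.mem_Icc]
      constructor
      · intro i
        have : k i + ⌊(-w) i⌋ ≤ ⌊(x - w) i⌋ := by
          rw [Int.le_floor, Pi.sub_apply]
          push_cast
          have := Int.floor_le ((-w) i)
          rw [Pi.neg_apply] at *
          linarith [(hx i).1]
        show 0 ≤ ⌊(x - w) i⌋ - (k i + ⌊(-w) i⌋)
        linarith
      · intro i
        have : ⌊(x - w) i⌋ < k i + ⌊(-w) i⌋ + 2 := by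
          rw [Int.floor_lt, Pi.sub_apply]
          push_cast
          have := Int.lt_floor_add_one ((-w) i)
          rw [Pi.neg_apply] at *
          linarith [(hx i).2]
        show ⌊(x - w) i⌋ - (k i + ⌊(-w) i⌋) ≤ 1
        linarith
    have h3 := Finset.single_le_sum (f := fun j => |p (k + m w + j) - p (k + m w)|)
      (fun j _ => abs_nonneg _) hmem
    have h4 : k + m w + (fun i => ⌊(x - w) i⌋ - (k + m w) i) = fun i => ⌊(x - w) i⌋ := by
      funext i; simp
    simp only [h4] at h3
    have h5 := (le_abs_self _).trans h3
    show p _ ≤ p (k + m w) + D (k + m w)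
    linarith
  have hsum : Summable fun k => sSup (densityError p (n + 1) k '' cubeAt k) := by
    refine Summable.of_abs (hEs.of_nonneg_of_le (fun _ => abs_nonneg _) fun k => ?_)
    refine abs_le.2 ⟨?_, csSup_le ((hne k).image _) ?_⟩
    · exact (abs_le.1 (hE k _ (latticePoint_mem_cubeAt k))).1.trans
        (le_csSup (hbdd' k) ⟨_, latticePoint_mem_cubeAt k, rfl⟩)
    · rintro _ ⟨x, hx, rfl⟩
      exact (le_abs_self _).trans (hE k x hx)
  refine ⟨hbdd, hsum, ?_, habs_sum, (habs_sum.tsum_le_tsum habs_le hEs).trans hEt⟩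
  -- The averaged translates of `p` and `p` itself both sum to 1, so the lower bounds sum to 0 and
  -- the upper bounds to the sum of `D`.
  have h1 := hasSum_le hlow (ha.sub hp) hsum.hasSum
  have h2 := hasSum_le hup hsum.hasSum ((ha.add hb).sub hp)
  have hD : 0 ≤ ∑' k, ∑ j ∈ Finset.Icc (0 : Fin d → ℤ) 1, |p (k + j) - p k| := tsum_nonneg hD0
  rw [abs_le]
  constructor
  · linarith
  · linarith

end Smoothing

/-! ### The law of `S + U_1 + ⋯ + U_n` -/

section Law

variable {d : ℕ}

/-- The uniform distribution on the unit cube. -/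
noncomputable def cubeUniform (d : ℕ) : Measure (Fin d → ℝ) := volume.restrict (cubeAt 0)

instance (d : ℕ) : IsProbabilityMeasure (cubeUniform d) :=
  ⟨by rw [cubeUniform, Measure.restrict_apply_univ, volume_cubeAt]⟩

/-- The law of a sum of `n` independent uniform random vectors on the unit cube. -/
noncomputable def cubeUniformSum (d : ℕ) : ℕ → Measure (Fin d → ℝ)
  | 0 => Measure.dirac 0
  | n + 1 => (cubeUniform d).conv (cubeUniformSum d n)

theorem isProbabilityMeasure_cubeUniformSum (d n : ℕ) :
    IsProbabilityMeasure (cubeUniformSum d n) := by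
  induction n with
  | zero => rw [cubeUniformSum]; infer_instance
  | succ n ih => rw [cubeUniformSum]; infer_instance

instance (d n : ℕ) : IsProbabilityMeasure (cubeUniformSum d n) :=
  isProbabilityMeasure_cubeUniformSum d n

theorem measurable_latticePoint : Measurable (latticePoint : (Fin d → ℤ) → Fin d → ℝ) :=
  measurable_of_countable _

theorem floor_preimage_singleton (k : Fin d → ℤ) :
    (fun x : Fin d → ℝ => fun i => ⌊x i⌋) ⁻¹' {k} = cubeAt k := by
  ext x
  simp only [Set.mem_preimage, Set.mem_singleton_iff, funext_iff, Int.floor_eq_iff]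
  rfl

/-- On a measurable `s` both measures equal the sum over `k` of `κ {k}` times the volume of `cubeAt
k ∩ s`. -/
theorem conv_cubeUniform_eq_withDensity (κ : Measure (Fin d → ℤ)) [IsProbabilityMeasure κ] :
    (κ.map latticePoint).conv (cubeUniform d) =
      volume.withDensity fun x => κ {fun i => ⌊x i⌋} := by
  have : IsProbabilityMeasure (κ.map (latticePoint : (Fin d → ℤ) → Fin d → ℝ)) :=
    Measure.isProbabilityMeasure_map measurable_latticePoint.aemeasurable
  refine Measure.ext fun s hs => ?_
  have hind : Measurable (s.indicator fun _ => (1 : ENNReal)) := measurable_const.indicator hs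
  rw [← lintegral_indicator_one hs]
  simp only [Pi.one_def]
  have hind2 : Measurable fun x : Fin d → ℝ =>
      ∫⁻ y, s.indicator (fun _ => (1 : ENNReal)) (x + y) ∂cubeUniform d :=
    Measurable.lintegral_prod_right'
      (f := fun z : (Fin d → ℝ) × (Fin d → ℝ) => s.indicator (fun _ => (1 : ENNReal)) (z.1 + z.2))
      (hind.comp (measurable_fst.add measurable_snd))
  rw [Measure.lintegral_conv hind, lintegral_map hind2 measurable_latticePoint,
    lintegral_countable', withDensity_apply _ hs]
  have hmap : ∫⁻ x in s, κ {fun i => ⌊x i⌋} =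
      ∫⁻ k, κ {k} ∂((volume.restrict s).map fun x : Fin d → ℝ => fun i => ⌊x i⌋) :=
    (lintegral_map (f := fun k : Fin d → ℤ => κ {k}) (measurable_of_countable _)
      measurable_floor_pi).symm
  rw [hmap, lintegral_countable']
  refine tsum_congr fun k => ?_
  rw [Measure.map_apply measurable_floor_pi (MeasurableSet.singleton k), floor_preimage_singleton,
    Measure.restrict_apply (measurableSet_cubeAt k), mul_comm]
  congr 1
  rw [cubeUniform, ← lintegral_indicator (measurableSet_cubeAt 0)]
  have hm : MeasurableSet (cubeAt k ∩ s) := (measurableSet_cubeAt k).inter hs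
  rw [← lintegral_indicator_one hm,
    ← lintegral_add_left_eq_self ((cubeAt k ∩ s).indicator 1) (latticePoint k)]
  refine lintegral_congr fun y => ?_
  have hmem : latticePoint k + y ∈ cubeAt k ↔ y ∈ cubeAt (0 : Fin d → ℤ) := by
    refine forall_congr' fun i => ?_
    simp only [latticePoint, Pi.add_apply, Pi.zero_apply, Int.cast_zero, zero_add,
      le_add_iff_nonneg_right, add_lt_add_iff_left]
  by_cases h1 : y ∈ cubeAt (0 : Fin d → ℤ) <;> by_cases h2 : latticePoint k + y ∈ s <;>
    simp [Set.indicator, h1, h2, hmem]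

theorem smoothedDensity_regular {p : (Fin d → ℤ) → ℝ} (hp0 : ∀ k, 0 ≤ p k) (hp1 : ∀ k, p k ≤ 1)
    (n : ℕ) : Measurable (smoothedDensity p (n + 1)) ∧
      (∀ x, 0 ≤ smoothedDensity p (n + 1) x) ∧ ∀ x, smoothedDensity p (n + 1) x ≤ 1 := by
  obtain ⟨ν, hν, -, hint⟩ := exists_averaging (d := d) n
  have hfn := hint p hp0 hp1
  have hmeas : Measurable fun z : (Fin d → ℝ) × (Fin d → ℝ) => p fun i => ⌊(z.1 - z.2) i⌋ :=
    (measurable_of_countable p).comp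
      (measurable_floor_pi.comp (measurable_fst.sub measurable_snd))
  refine ⟨?_, fun x => ?_, fun x => ?_⟩
  · have h := (StronglyMeasurable.integral_prod_right (ν := ν)
      (f := fun x w => p fun i => ⌊(x - w) i⌋) hmeas.stronglyMeasurable).measurable
    exact (funext hfn : smoothedDensity p (n + 1) = _) ▸ h
  · rw [hfn]
    exact integral_nonneg fun _ => hp0 _
  · rw [hfn]
    have h := integral_mono_of_nonneg (μ := ν) (ae_of_all _ fun w => hp0 fun i => ⌊(x - w) i⌋)
      (integrable_const (1 : ℝ)) (ae_of_all _ fun w => hp1 fun i => ⌊(x - w) i⌋)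
    simpa using h

theorem conv_cubeUniformSum_eq_withDensity (κ : Measure (Fin d → ℤ)) [IsProbabilityMeasure κ]
    (n : ℕ) :
    (κ.map latticePoint).conv (cubeUniformSum d (n + 1)) =
      volume.withDensity fun x =>
        ENNReal.ofReal (smoothedDensity (fun k => κ.real {k}) (n + 1) x) := by
  have : IsProbabilityMeasure (κ.map (latticePoint : (Fin d → ℤ) → Fin d → ℝ)) :=
    Measure.isProbabilityMeasure_map measurable_latticePoint.aemeasurable
  have hp0 : ∀ k, 0 ≤ κ.real {k} := fun _ => measureReal_nonneg
  have hp1 : ∀ k, κ.real {k} ≤ 1 := fun _ => measureReal_le_one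
  induction n with
  | zero =>
    rw [cubeUniformSum, cubeUniformSum, Measure.conv_dirac_zero, conv_cubeUniform_eq_withDensity]
    congr 1
    funext x
    simp [smoothedDensity]
  | succ n ih =>
    obtain ⟨hmeas, h0, h1⟩ := smoothedDensity_regular hp0 hp1 n
    have hlam : cubeUniform d = volume.withDensity ((cubeAt (0 : Fin d → ℤ)).indicator 1) := by
      rw [cubeUniform, withDensity_indicator_one (measurableSet_cubeAt 0)]
    -- Commuting the new uniform factor to the front matches the recursion that defines
    -- `smoothedDensity`.
    rw [cubeUniformSum, ← Measure.conv_assoc, Measure.conv_comm _ (cubeUniform d),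
      Measure.conv_assoc, ih, hlam, conv_withDensity_eq_lconvolution
        (measurable_one.indicator (measurableSet_cubeAt 0)) hmeas.ennreal_ofReal]
    congr 1
    funext x
    rw [lconvolution_def]
    show _ = ENNReal.ofReal (∫ u in cubeAt (0 : Fin d → ℤ),
      smoothedDensity (fun k => κ.real {k}) (n + 1) (x - u))
    have hfin : IsFiniteMeasure (volume.restrict (cubeAt (0 : Fin d → ℤ))) :=
      inferInstanceAs (IsFiniteMeasure (cubeUniform d))
    have hint : Integrable (fun u => smoothedDensity (fun k => κ.real {k}) (n + 1) (x - u))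
        (volume.restrict (cubeAt 0)) :=
      Integrable.of_bound (hmeas.comp (by fun_prop)).aestronglyMeasurable 1
        (ae_of_all _ fun u => by rw [Real.norm_of_nonneg (h0 _)]; exact h1 _)
    rw [ofReal_integral_eq_lintegral_ofReal hint (ae_of_all _ fun u => h0 _),
      ← lintegral_indicator (measurableSet_cubeAt 0)]
    refine lintegral_congr fun u => ?_
    by_cases hu : u ∈ cubeAt (0 : Fin d → ℤ)
    · simp [hu, sub_eq_neg_add]
    · simp [hu]

variable {Ω : Type*} [MeasurableSpace Ω] {P : Measure Ω} [IsProbabilityMeasure P]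

theorem measurable_finsetSum_fn {ι : Type*} {U : ι → Ω → Fin d → ℝ} (hU : ∀ i, Measurable (U i))
    (s : Finset ι) : Measurable (∑ i ∈ s, U i) := by
  have h : ∑ i ∈ s, U i = fun ω => ∑ i ∈ s, U i ω := by
    funext ω
    exact Finset.sum_apply ω s U
  rw [h]
  exact Finset.measurable_sum s fun i _ => hU i

theorem map_sum_uniform {ι : Type*} {U : ι → Ω → Fin d → ℝ} (hU : ∀ i, Measurable (U i))
    (hunif : ∀ i, pdf.IsUniform (U i) (cubeAt (0 : Fin d → ℤ)) P volume) (hind : iIndepFun U P)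
    (s : Finset ι) : P.map (∑ i ∈ s, U i) = cubeUniformSum d s.card := by
  classical
  induction s using Finset.induction_on with
  | empty =>
    rw [Finset.sum_empty, Finset.card_empty, cubeUniformSum]
    show P.map (fun _ => (0 : Fin d → ℝ)) = _
    rw [Measure.map_const, measure_univ, one_smul]
  | insert i s hi ih =>
    have hUi : P.map (U i) = cubeUniform d := by
      have h := hunif i
      rw [pdf.IsUniform, ProbabilityTheory.cond, volume_cubeAt, inv_one, one_smul] at h
      exact h
    rw [Finset.sum_insert hi, Finset.card_insert_of_notMem hi, cubeUniformSum,
      IndepFun.map_add_eq_map_conv_map (hU i) (measurable_finsetSum_fn hU s)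
        (hind.indepFun_finsetSum_of_notMem hU hi).symm, ih, hUi]

theorem map_add_sum_eq_withDensity {n : ℕ} {S : Ω → Fin d → ℤ} {U : Fin (n + 1) → Ω → Fin d → ℝ}
    (hS : Measurable S) (hU : ∀ i, Measurable (U i))
    (hunif : ∀ i, pdf.IsUniform (U i) (cubeAt (0 : Fin d → ℤ)) P volume) (hind : iIndepFun U P)
    (hSU : IndepFun S (fun ω i => U i ω) P) :
    P.map (fun ω => latticePoint (S ω) + ∑ i, U i ω) =
      volume.withDensity
        (fun x => ENNReal.ofReal (smoothedDensity (massFunction P S) (n + 1) x)) := by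
  have hκ : IsProbabilityMeasure (P.map S) := Measure.isProbabilityMeasure_map hS.aemeasurable
  have hmass : massFunction P S = fun k => (P.map S).real {k} := by
    funext k
    rw [massFunction, map_measureReal_apply hS (MeasurableSet.singleton k)]
  have hsum : (fun ω => ∑ i, U i ω) = ∑ i, U i := by
    funext ω
    simp
  have hfun : (fun ω => latticePoint (S ω) + ∑ i, U i ω) = latticePoint ∘ S + ∑ i, U i := by
    rw [← hsum]; rfl
  have hindep : IndepFun (latticePoint ∘ S) (∑ i, U i) P := by
    rw [← hsum]
    exact hSU.comp (φ := latticePoint) (ψ := fun u : Fin (n + 1) → Fin d → ℝ => ∑ i, u i)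
      measurable_latticePoint (by fun_prop)
  rw [hfun, hindep.map_add_eq_map_conv_map (measurable_latticePoint.comp hS)
    (measurable_finsetSum_fn hU _), map_sum_uniform hU hunif hind,
    Finset.card_univ, Fintype.card_fin, ← Measure.map_map measurable_latticePoint hS,
    conv_cubeUniformSum_eq_withDensity, hmass]

theorem hasSum_massFunction {S : Ω → Fin d → ℤ} (hS : Measurable S) :
    HasSum (massFunction P S) 1 := by
  have hκ : IsProbabilityMeasure (P.map S) := Measure.isProbabilityMeasure_map hS.aemeasurable
  have h : ∑' k, (P.map S) {k} = 1 := by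
    have := lintegral_countable' (μ := P.map S) fun _ => 1
    simpa using this.symm
  have h2 := ENNReal.hasSum_toReal (f := fun k => (P.map S) {k}) (by simp [h])
  rw [← ENNReal.tsum_toReal_eq (fun k => measure_ne_top _ _), h, ENNReal.toReal_one] at h2
  refine h2.congr_fun fun k => ?_
  rw [massFunction, ← map_measureReal_apply hS (MeasurableSet.singleton k)]
  rfl

end Law

/-! ### Assembly of the main theorem. -/

theorem mainTheorem11 (d : ℕ) (hd : 1 ≤ d) :
    ∃ (C : ℝ) (C' : ℕ → ℝ), ∀ K : ℝ, ∃ N : ℝ, ∀ n : ℕ, 1 ≤ n →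
      ∀ (Ω : Type*) [MeasurableSpace Ω] (P : Measure Ω) [IsProbabilityMeasure P]
        (S : Ω → (Fin d → ℤ)) (U : Fin n → Ω → (Fin d → ℝ)) (f : (Fin d → ℝ) → ℝ),
        Measurable S → (∀ i, Measurable (U i)) →
        (∀ i, pdf.IsUniform (U i) (cubeAt (0 : Fin d → ℤ)) P volume) →
        iIndepFun U P → IndepFun S (fun ω i => U i ω) P →
        IsLogConcaveExtension (massFunction P S) f →
        Integrable f volume → 0 < ∫ x, f x →
        IsAlmostIsotropicWith K f → N ≤ detScale (covReal f) →
        P.map (fun ω => latticePoint (S ω) + ∑ i, U i ω) =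
            volume.withDensity
              (fun x => ENNReal.ofReal (smoothedDensity (massFunction P S) n x)) ∧
          0 < (covInt (massFunction P S)).det ∧
          (∀ k, BddAbove ((fun x => |densityError (massFunction P S) n k x|) '' cubeAt k)) ∧
          Summable (fun k => sSup (densityError (massFunction P S) n k '' cubeAt k)) ∧
          |∑' k, sSup (densityError (massFunction P S) n k '' cubeAt k)| ≤
            C / detScale (covInt (massFunction P S)) ∧
          Summable
            (fun k => sSup ((fun x => |densityError (massFunction P S) n k x|) '' cubeAt k)) ∧
          ∑' k, sSup ((fun x => |densityError (massFunction P S) n k x|) '' cubeAt k) ≤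
            C' n / detScale (covInt (massFunction P S)) := by
  obtain ⟨V, L, hL, hV, N, hN1, hest⟩ := IsLogConcaveExtension.exists_estimates d hd
  refine ⟨totalLength (Finset.Icc (0 : Fin d → ℤ) 1) * (V * L),
    fun n => totalLength (Finset.Icc (fun _ : Fin d => -((n - 1 : ℕ) : ℤ)) 0) * (V * L),
    -- Almost isotropy enters only here: `σ ≥ K` turns `σ² + Kσ` into at most `2σ²` on the diagonal.
    fun K => ⟨max N K, ?_⟩⟩
  intro n hn Ω _ P _ S U f hS hU hunif hind hSU hext hi hpos hiso hσ
  obtain ⟨n, rfl⟩ : ∃ m, n = m + 1 := ⟨n - 1, by omega⟩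
  have hsum := hasSum_massFunction (P := P) hS
  have hσN := (le_max_left _ _).trans hσ
  have hσK := (le_max_right _ _).trans hσ
  have hσ0 : 0 < detScale (covReal f) := by linarith
  obtain ⟨hdet, hscale, hvar⟩ := hest (massFunction P S) f hsum hext hi hpos hσN fun i => by
    have h := (abs_le.1 (hiso i i)).2
    rw [if_pos rfl] at h
    nlinarith
  have hdet0 : 0 < detScale (covInt (massFunction P S)) := Real.rpow_pos_of_pos hdet _
  obtain ⟨h1, h2, h3, h4, h5⟩ := densityError_bounds (fun k => measureReal_nonneg) hsum hvar n
  have hconv : ∀ B : Finset (Fin d → ℤ), totalLength B * (V / detScale (covReal f)) ≤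
      totalLength B * (V * L) / detScale (covInt (massFunction P S)) := fun B => by
    have hB : 0 ≤ totalLength B :=
      Finset.sum_nonneg fun _ _ => Finset.sum_nonneg fun _ _ => abs_nonneg _
    rw [mul_div_assoc]
    refine mul_le_mul_of_nonneg_left ?_ hB
    rw [div_le_div_iff₀ hσ0 hdet0, mul_assoc]
    exact mul_le_mul_of_nonneg_left hscale hV
  exact ⟨map_add_sum_eq_withDensity hS hU hunif hind hSU, hdet, h1, h2, h3.trans (hconv _), h4,
    h5.trans (hconv _)⟩
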